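/- Let $M$ be a unital complex $*$-algebra with a tracial state $\tau$ (for instance a tracial $W^*$-probability space), let $B\subset M$ be a unital subalgebra, let $N\ge 1$, $n\ge 0$, and let $X^k_{ij}\in M$ ($1\le i,j\le N$, $1\le k\le n$) satisfy $X^k_{ij}=(X^k_{ji})^*$. Let $Z_k=(X^k_{ij})_{i,j}\in M\otimes M_N=M_N(M)$, where $M_N(M)$ carries the normalized trace $a\mapsto \frac1N\sum_i\tau(a_{ii})$ and $B\otimes M_N$ is the subalgebra of matrices with entries in $B$. Put $$Y^k_{ij}=\tfrac12\big(X^k_{ij}+(X^k_{ij})^*\big)\ \text{ if } i\ge j,\qquad Y^k_{ij}=\tfrac1{2\sqrt{-1}}\big(X^k_{ij}-(X^k_{ij})^*\big)\ \text{ if } i<j .$$ Relative free entropy is defined as follows, in any unital complex $*$-algebra $A$ with normalized linear functional $\tau$. For self-adjoint tuples, $\Gamma_R(X_1,\dots,X_n;k,l,\epsilon)$ is the set of $n$-tuples $x$ of self-adjoint $k\times k$ matrices with operator norms $\|x_i\|\le R$ and $|\mathrm{tr}_k(x_{i_1}\cdots x_{i_p})-\tau(X_{i_1}\cdots X_{i_p})|<\epsilon$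 for all $p\le l$ and all $i_1,\dots,i_p$, where $\mathrm{tr}_k$ is the normalized trace. Let $\Gamma_R(X|y[Y];k,l,\epsilon)=\{x:(x,y)\in\Gamma_R(X,Y;k,l,\epsilon)\}$, let $\lambda$ be Lebesgue measure on $n$-tuples of self-adjoint $k\times k$ matrices for the inner product $\mathrm{Tr}(xy)$ of the non-normalized trace, and set, in $[-\infty,\infty]$, $$\chi_R(X|Y;l,\epsilon)=\limsup_{k\to\infty}\Big(\frac1{k^2}\sup_{y\in\Gamma_R(Y;k,l,\epsilon)}\log\lambda\,\Gamma_R(X|y[Y];k,l,\epsilon)+\frac n2\log k\Big),$$ $$\chi(X|Y)=\sup_{R>0}\ \inf_{l,\ \epsilon>0}\chi_R(X|Y;l,\epsilon),\qquad \chi(X|B)=\inf_{m}\ \inf_{Y_1,\dots,Y_m\in B\text{ self-adjoint}}\chi(X|Y_1,\dots,Y_m).$$ For a free ultrafilter $\omega$ on $\mathbb N$, $\chi^\omega$ is defined in the same way with $\lim_{k\to\omega}$ in place of $\limsup_{k\to\infty}$, and $N\omega$ is the free ultrafilter with $\lim_{k\to N\omega}f(k)=\lim_{m\to\omega}f(Nm)$.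 Then, for every free ultrafilter $\omega$ on $\mathbb N$, $$\chi^{\omega}\big(\{Y^k_{ij}\}_{i,j,k}\,\big|\,B\big)=N^2\,\chi^{N\omega}(Z_1,\dots,Z_n|B\otimes M_N)-N^2\frac n2\log N-\frac{nN(N-1)}2\log 2 .$$ Moreover, $$\chi\big(\{Y^k_{ij}\}_{i,j,k}\,\big|\,B\big)\le N^2\,\chi(Z_1,\dots,Z_n|B\otimes M_N)-N^2\frac n2\log N-\frac{nN(N-1)}2\log 2 .$$ -/

import Mathlib

noncomputable section

namespace RelFreeEntropy

/-- A tracial state on a unital complex `*`-algebra (with `0 ≤ z` for complex `z` spelled out). -/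
structure IsTracialState {A : Type*} [Ring A] [StarRing A] [Algebra ℂ A] (τ : A →ₗ[ℂ] ℂ) :
    Prop where
  map_one : τ 1 = 1
  tracial : ∀ a b : A, τ (a * b) = τ (b * a)
  pos : ∀ a : A, 0 ≤ (τ (star a * a)).re ∧ (τ (star a * a)).im = 0

/-- The operator norm of a `k × k` matrix acting on the Euclidean space `ℂ ^ k`. -/
def opNorm {k : ℕ} (x : Matrix (Fin k) (Fin k) ℂ) : ℝ :=
  ‖Matrix.toEuclideanCLM (n := Fin k) (𝕜 := ℂ) x‖

/-- The set `Γ_R(X ; k, l, ε)` of microstates of the tuple `X = (X_i)_{i ∈ ι}`: the tuples of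
self-adjoint `k × k` matrices of operator norm at most `R` whose mixed moments of length at most
`l`, in the normalized trace, are `ε`-close to those of `X`. -/
def microstates {A ι : Type*} [Ring A] [Algebra ℂ A] (τ : A →ₗ[ℂ] ℂ) (X : ι → A)
    (R : ℝ) (k l : ℕ) (ε : ℝ) : Set (ι → Matrix (Fin k) (Fin k) ℂ) :=
  {x | (∀ i, (x i).IsHermitian) ∧ (∀ i, opNorm (x i) ≤ R) ∧
    ∀ w : List ι, w.length ≤ l →
      ‖(k : ℂ)⁻¹ * (w.map x).prod.trace - τ (w.map X).prod‖ < ε}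

/-- The set `Γ_R(X | y [Y] ; k, l, ε)`: the tuples `x` such that `(x, y)` is a microstate of
`(X, Y)`. -/
def relMicrostates {A ι κ : Type*} [Ring A] [Algebra ℂ A] (τ : A →ₗ[ℂ] ℂ)
    (X : ι → A) (Y : κ → A) (R : ℝ) (k l : ℕ) (ε : ℝ)
    (y : κ → Matrix (Fin k) (Fin k) ℂ) : Set (ι → Matrix (Fin k) (Fin k) ℂ) :=
  {x | Sum.elim x y ∈ microstates τ (Sum.elim X Y) R k l ε}

/-- Orthonormal coordinates on the self-adjoint `k × k` matrices, with the inner product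
`⟨x, y⟩ = Tr (x y)` (see `trace_hermOfCoords_mul` and `exists_hermOfCoords_eq`): the diagonal
entries, and the real and imaginary parts of the entries above the diagonal times `√2`. -/
def hermOfCoords {k : ℕ} (c : Fin k → Fin k → ℝ) : Matrix (Fin k) (Fin k) ℂ :=
  Matrix.of fun i j =>
    if i = j then (c i i : ℂ)
    else if i < j then ((c i j : ℂ) + (c j i : ℂ) * Complex.I) / ((√2 : ℝ) : ℂ)
    else ((c j i : ℂ) - (c i j : ℂ) * Complex.I) / ((√2 : ℝ) : ℂ)

/-- Lebesgue measure `λ` on tuples of self-adjoint `k × k` matrices, for the Hilbert space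
structure given by the non-normalized trace. -/
def lebesgue {ι : Type*} [Fintype ι] {k : ℕ} (S : Set (ι → Matrix (Fin k) (Fin k) ℂ)) :
    ENNReal :=
  MeasureTheory.volume
    {c : ι → Fin k → Fin k → ℝ | (fun i => hermOfCoords (c i)) ∈ S}

/-- `χ_R(X | Y ; l, ε)`, with the limit over matrix sizes `k` taken as a `limsup` along a filter
`F` on `ℕ`. For `F = atTop` this is the usual `limsup`; for an ultrafilter `F = ω` it is the limit
`lim_{k → ω}` (see `tendsto_limsup_ultrafilter`). -/
def chiRle {A ι κ : Type*} [Fintype ι] [Ring A] [Algebra ℂ A] (F : Filter ℕ) (τ : A →ₗ[ℂ] ℂ)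
    (X : ι → A) (Y : κ → A) (R : ℝ) (l : ℕ) (ε : ℝ) : EReal :=
  Filter.limsup (fun k : ℕ =>
    ((((k : ℝ) ^ 2)⁻¹ : ℝ) : EReal) *
      (⨆ y ∈ microstates τ Y R k l ε, ENNReal.log (lebesgue (relMicrostates τ X Y R k l ε y)))
    + (((Fintype.card ι : ℝ) / 2 * Real.log k : ℝ) : EReal)) F

/-- `χ_R(X | Y) = inf_{l, ε} χ_R(X | Y ; l, ε)`. -/
def chiR {A ι κ : Type*} [Fintype ι] [Ring A] [Algebra ℂ A] (F : Filter ℕ) (τ : A →ₗ[ℂ] ℂ)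
    (X : ι → A) (Y : κ → A) (R : ℝ) : EReal :=
  ⨅ (l : ℕ) (ε : ℝ) (_ : 0 < ε), chiRle F τ X Y R l ε

/-- The relative free entropy `χ(X | Y) = sup_R χ_R(X | Y)` of `X` with respect to the
tuple `Y`. -/
def chiRel {A ι κ : Type*} [Fintype ι] [Ring A] [Algebra ℂ A] (F : Filter ℕ) (τ : A →ₗ[ℂ] ℂ)
    (X : ι → A) (Y : κ → A) : EReal :=
  ⨆ (R : ℝ) (_ : 0 < R), chiR F τ X Y R

/-- The free entropy `χ(X | B)` of `X` relative to a unital subalgebra `B`: the infimum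
of `χ(X | Y_1, …, Y_m)` over all finite tuples of self-adjoint elements of `B`. -/
def chi {A ι : Type*} [Fintype ι] [Ring A] [StarRing A] [Algebra ℂ A] (F : Filter ℕ)
    (τ : A →ₗ[ℂ] ℂ) (X : ι → A) (B : Subalgebra ℂ A) : EReal :=
  ⨅ (m : ℕ) (Y : Fin m → A) (_ : ∀ j, Y j ∈ B ∧ IsSelfAdjoint (Y j)), chiRel F τ X Y

/-- The normalized trace `a ↦ N⁻¹ ∑ i, τ (a i i)` on `M ⊗ M_N = M_N(M)`. -/
def matTrace {M : Type*} [Ring M] [Algebra ℂ M] (N : ℕ) (τ : M →ₗ[ℂ] ℂ) :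
    Matrix (Fin N) (Fin N) M →ₗ[ℂ] ℂ :=
  (N : ℂ)⁻¹ • (τ ∘ₗ Matrix.traceLinearMap (Fin N) ℂ M)

/-- The family `Y_{ij}^k`: the real part of `X_{ij}^k` if `i ≥ j`, its imaginary part
if `i < j`. -/
def entryParts {M : Type*} [Ring M] [StarRing M] [Algebra ℂ M] {n N : ℕ}
    (X : Fin n → Fin N → Fin N → M) : Fin n × Fin N × Fin N → M :=
  fun p =>
    if p.2.2 ≤ p.2.1 then
      (1 / 2 : ℂ) • (X p.1 p.2.1 p.2.2 + star (X p.1 p.2.1 p.2.2))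
    else
      (1 / (2 * Complex.I) : ℂ) • (X p.1 p.2.1 p.2.2 - star (X p.1 p.2.1 p.2.2))

/-- The ultrafilter `N ω`, with `lim_{k → N ω} f k = lim_{m → ω} f (N m)`. -/
def mulUltrafilter (N : ℕ) (ω : Ultrafilter ℕ) : Ultrafilter ℕ :=
  ω.map (fun m => N * m)

/-- Along an ultrafilter, the `limsup` of extended reals is a genuine limit. -/
theorem tendsto_limsup_ultrafilter (ω : Ultrafilter ℕ) (u : ℕ → EReal) :
    Filter.Tendsto u ω (nhds (Filter.limsup u ω)) := by
  obtain ⟨a, -, ha⟩ := isCompact_univ.ultrafilter_le_nhds (ω.map u) (by simp)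
  have h : Filter.Tendsto u ω (nhds a) := ha
  rwa [h.limsup_eq]

theorem isHermitian_hermOfCoords {k : ℕ} (c : Fin k → Fin k → ℝ) :
    (hermOfCoords c).IsHermitian := by
  ext i j
  rcases lt_trichotomy i j with h | h | h
  · simp [hermOfCoords, h.ne, h.ne', h, h.not_gt]
  · subst h; simp [hermOfCoords]
  · simp [hermOfCoords, h.ne, h.ne', h, h.not_gt, sub_eq_add_neg]

theorem exists_hermOfCoords_eq {k : ℕ} (x : Matrix (Fin k) (Fin k) ℂ) (hx : x.IsHermitian) :
    ∃ c, hermOfCoords c = x := by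
  have h2 : ((√2 : ℝ) : ℂ) ≠ 0 := by simp
  refine ⟨fun i j => if i = j then (x i i).re else if i < j then √2 * (x i j).re
    else √2 * (x j i).im, ?_⟩
  ext i j
  have hs : ∀ i j, star (x j i) = x i j := fun i j => hx.apply i j
  rcases lt_trichotomy i j with h | h | h
  · simp only [hermOfCoords, Matrix.of_apply, h.ne, h.ne', h, h.not_gt, if_true, if_false]
    rw [div_eq_iff h2]
    apply Complex.ext <;> simp [mul_comm]
  · subst h
    have := congrArg Complex.im (hs i i)
    simp at this
    apply Complex.ext
    · simp [hermOfCoords]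
    · simp [hermOfCoords]; linarith
  · simp only [hermOfCoords, Matrix.of_apply, h.ne, h.ne', h, h.not_gt, if_true, if_false]
    rw [div_eq_iff h2, ← hs i j]
    apply Complex.ext <;> simp [mul_comm]

theorem trace_hermOfCoords_mul {k : ℕ} (c d : Fin k → Fin k → ℝ) :
    (hermOfCoords c * hermOfCoords d).trace = ((∑ i, ∑ j, c i j * d i j : ℝ) : ℂ) := by
  have h2 : ((√2 : ℝ) : ℂ) ^ 2 = 2 := by
    rw [← Complex.ofReal_pow, Real.sq_sqrt (by norm_num)]; norm_num
  have h0 : ((√2 : ℝ) : ℂ) ≠ 0 := by simp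
  have key : ∀ i j : Fin k, hermOfCoords c i j * hermOfCoords d j i
      + hermOfCoords c j i * hermOfCoords d i j
      = ((c i j * d i j + c j i * d j i : ℝ) : ℂ) := by
    intro i j
    rcases lt_trichotomy i j with h | h | h
    · simp only [hermOfCoords, Matrix.of_apply, h.ne, h.ne', h, h.not_gt, if_true, if_false]
      push_cast
      field_simp
      rw [h2]
      linear_combination (-2 * (c j i : ℂ) * d j i) * Complex.I_sq
    · subst h; simp [hermOfCoords]
    · simp only [hermOfCoords, Matrix.of_apply, h.ne, h.ne', h, h.not_gt, if_true, if_false]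
      push_cast
      field_simp
      rw [h2]
      linear_combination (-2 * (c i j : ℂ) * d i j) * Complex.I_sq
  have e1 : (hermOfCoords c * hermOfCoords d).trace
      = ∑ i, ∑ j, hermOfCoords c i j * hermOfCoords d j i := by
    simp [Matrix.trace, Matrix.mul_apply]
  have e2 : (hermOfCoords c * hermOfCoords d).trace
      = ∑ i, ∑ j, hermOfCoords c j i * hermOfCoords d i j := by
    rw [e1, Finset.sum_comm]
  have e3 : (∑ i, ∑ j, c i j * d i j) = ∑ i, ∑ j, c j i * d j i := Finset.sum_comm
  have e4 : (2 : ℂ) * (hermOfCoords c * hermOfCoords d).trace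
      = 2 * ((∑ i, ∑ j, c i j * d i j : ℝ) : ℂ) := by
    calc _ = (hermOfCoords c * hermOfCoords d).trace
          + (hermOfCoords c * hermOfCoords d).trace := two_mul _
      _ = ∑ i, ∑ j, ((c i j * d i j + c j i * d j i : ℝ) : ℂ) := by
          conv_lhs => rw [e2]
          rw [← e2]
          nth_rewrite 1 [e1]
          rw [e2, ← Finset.sum_add_distrib]
          refine Finset.sum_congr rfl fun i _ => ?_
          rw [← Finset.sum_add_distrib]
          exact Finset.sum_congr rfl fun j _ => key i j
      _ = _ := by
          rw [two_mul]
          nth_rewrite 2 [e3]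
          push_cast
          rw [← Finset.sum_add_distrib]
          refine Finset.sum_congr rfl fun i _ => ?_
          rw [← Finset.sum_add_distrib]
  exact mul_left_cancel₀ two_ne_zero e4

end RelFreeEntropy

end

/-! An identification of `ℂ^(N m)` with `N` orthogonal copies of `ℂ^m` (a frame) turns a tuple of
self-adjoint `N m × N m` matrices into the self-adjoint parts of its `m × m` blocks. This map is
linear, and it becomes isometric for the trace inner products once the off-diagonal parts are
multiplied by `√2`. Its Jacobian `√2 ^ (n N (N - 1) m ^ 2)` gives the `log 2` term, and the
difference between `log (N m)` and `log m` in the normalization gives the `log N` term. The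
prefactor `N ^ 2` comes from `(N m) ^ 2` against `m ^ 2`. It remains to compare microstates.

Upper bound: for self-adjoint matrices `W` over `B`, moments of `(Z, W)` are polynomials in the
entries. Along any frame, blocks which are microstates of the entries of `Z` and `W` therefore
assemble to microstates of `(Z, W)` (`exists_assemble_mem_microstates`).

Lower bound: for self-adjoint `b` in `B`, condition `Z` on the diagonal matrices with constant entry
`b`, one diagonal matrix unit, and the transposition matrices moving it around. In a microstate
these are matrix units only approximately, in the normalized Frobenius norm. A spectral cut-off and
an approximate polar decomposition correct them to an exact frame (`exists_isAdapted`), along which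
the blocks have almost the moments of the entries (`MomentsTendsto.blocks`). The frame depends only
on the conditioning microstate, so a single linear change of variables serves the whole fibre.

The `ε` bookkeeping is replaced by sequences converging in moments
(`exists_forall_mem_microstates_map`). The lower bound sees only sizes divisible by `N`: these are
exactly the sizes seen by `N ω`, whereas an ordinary limsup over all sizes can be larger, which
leaves one inequality. -/

noncomputable section

namespace RelFreeEntropy

open Matrix MeasureTheory Filter Topology
open scoped Matrix.Norms.L2Operator

/-! ### Frobenius norm estimates. -/

section Frobenius

variable {I J K : Type*} [Fintype I] [Fintype J] [Fintype K]

/-- The Frobenius norm of a rectangular complex matrix. -/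
def frob (A : Matrix I J ℂ) : ℝ :=
  ‖(WithLp.toLp 2 (fun p : I × J => A p.1 p.2) : EuclideanSpace ℂ (I × J))‖

theorem frob_nonneg (A : Matrix I J ℂ) : 0 ≤ frob A := norm_nonneg _

theorem frob_sq (A : Matrix I J ℂ) : frob A ^ 2 = ∑ i, ∑ j, ‖A i j‖ ^ 2 := by
  rw [frob, EuclideanSpace.norm_sq_eq, Fintype.sum_prod_type]

theorem frob_add_le (A B : Matrix I J ℂ) : frob (A + B) ≤ frob A + frob B :=
  norm_add_le (WithLp.toLp 2 (fun p : I × J => A p.1 p.2) : EuclideanSpace ℂ (I × J))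
    (WithLp.toLp 2 (fun p : I × J => B p.1 p.2))

theorem frob_smul (c : ℂ) (A : Matrix I J ℂ) : frob (c • A) = ‖c‖ * frob A :=
  norm_smul c (WithLp.toLp 2 (fun p : I × J => A p.1 p.2) : EuclideanSpace ℂ (I × J))

theorem frob_neg (A : Matrix I J ℂ) : frob (-A) = frob A := by
  simpa using frob_smul (-1) A

theorem frob_sub_comm (A B : Matrix I J ℂ) : frob (A - B) = frob (B - A) := by
  rw [← frob_neg, neg_sub]

theorem frob_zero : frob (0 : Matrix I J ℂ) = 0 := by
  simpa using frob_smul 0 (0 : Matrix I J ℂ)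

theorem frob_sub_le (A B C : Matrix I J ℂ) : frob (A - C) ≤ frob (A - B) + frob (B - C) := by
  simpa using frob_add_le (A - B) (B - C)

theorem frob_conjTranspose (A : Matrix I J ℂ) : frob Aᴴ = frob A := by
  rw [← sq_eq_sq₀ (frob_nonneg _) (frob_nonneg _), frob_sq, frob_sq, Finset.sum_comm]
  simp

theorem frob_sq_eq_trace (A : Matrix I J ℂ) : ((frob A ^ 2 : ℝ) : ℂ) = (Aᴴ * A).trace := by
  rw [frob_sq, Finset.sum_comm]
  simp only [Matrix.trace, Matrix.diag, Matrix.mul_apply, conjTranspose_apply]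
  push_cast
  refine Finset.sum_congr rfl fun i _ => Finset.sum_congr rfl fun j _ => ?_
  rw [Complex.star_def, Complex.conj_mul']

theorem frob_diagonal_sq [DecidableEq I] (v : I → ℂ) :
    frob (diagonal v) ^ 2 = ∑ i, ‖v i‖ ^ 2 := by
  rw [frob_sq]
  refine Finset.sum_congr rfl fun i _ => ?_
  rw [Finset.sum_eq_single i] <;> simp +contextual [eq_comm]

/-- The operator norm bound is applied to each column of `B`, and the squares are summed. -/
theorem frob_mul_le [DecidableEq J] (A : Matrix I J ℂ) (B : Matrix J K ℂ) :
    frob (A * B) ≤ ‖A‖ * frob B := by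
  rw [← sq_le_sq₀ (frob_nonneg _) (mul_nonneg (norm_nonneg _) (frob_nonneg _)), mul_pow, frob_sq,
    frob_sq, Finset.sum_comm, Finset.sum_comm (f := fun i j => ‖B i j‖ ^ 2), Finset.mul_sum]
  refine Finset.sum_le_sum fun k _ => ?_
  have h := l2_opNorm_mulVec A (WithLp.toLp 2 (fun j => B j k))
  have h2 := pow_le_pow_left₀ (norm_nonneg _) h 2
  rw [mul_pow, EuclideanSpace.norm_sq_eq, EuclideanSpace.norm_sq_eq] at h2
  exact h2

theorem frob_mul_le' [DecidableEq I] [DecidableEq J] [DecidableEq K]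
    (A : Matrix I J ℂ) (B : Matrix J K ℂ) : frob (A * B) ≤ frob A * ‖B‖ := by
  have h := frob_mul_le Bᴴ Aᴴ
  rwa [← conjTranspose_mul, frob_conjTranspose, frob_conjTranspose, l2_opNorm_conjTranspose,
    mul_comm] at h

theorem norm_trace_mul_le (A : Matrix I J ℂ) (B : Matrix J I ℂ) :
    ‖(A * B).trace‖ ≤ frob A * frob B := by
  have h := norm_inner_le_norm (𝕜 := ℂ)
    (WithLp.toLp 2 (fun p : I × J => Aᴴ p.2 p.1) : EuclideanSpace ℂ (I × J))
    (WithLp.toLp 2 (fun p : I × J => B p.2 p.1))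
  have e1 : ‖(WithLp.toLp 2 (fun p : I × J => Aᴴ p.2 p.1) : EuclideanSpace ℂ (I × J))‖
      = frob A := by
    rw [← sq_eq_sq₀ (norm_nonneg _) (frob_nonneg _), EuclideanSpace.norm_sq_eq, frob_sq,
      Fintype.sum_prod_type]
    simp
  have e2 : ‖(WithLp.toLp 2 (fun p : I × J => B p.2 p.1) : EuclideanSpace ℂ (I × J))‖
      = frob B := by
    rw [← sq_eq_sq₀ (norm_nonneg _) (frob_nonneg _), EuclideanSpace.norm_sq_eq, frob_sq,
      Fintype.sum_prod_type, Finset.sum_comm]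
  rw [e1, e2] at h
  refine le_trans (le_of_eq (congrArg _ ?_)) h
  simp [Matrix.trace, Matrix.mul_apply, PiLp.inner_apply, Fintype.sum_prod_type, mul_comm]

theorem frob_one [DecidableEq I] : frob (1 : Matrix I I ℂ) = √(Fintype.card I) := by
  rw [← Real.sqrt_sq (frob_nonneg _), ← diagonal_one, frob_diagonal_sq]
  simp

theorem norm_trace_le [DecidableEq I] (A : Matrix I I ℂ) :
    ‖A.trace‖ ≤ √(Fintype.card I) * frob A := by
  simpa [frob_one] using norm_trace_mul_le 1 A

theorem norm_le_one_of_isometry [DecidableEq I] [DecidableEq J] {V : Matrix I J ℂ}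
    (hV : Vᴴ * V = 1) : ‖V‖ ≤ 1 := by
  have h := l2_opNorm_conjTranspose_mul_self V
  rw [hV, ← diagonal_one, l2_opNorm_diagonal] at h
  have h1 : ‖(fun _ : J => (1 : ℂ))‖ ≤ 1 := (pi_norm_le_iff_of_nonneg zero_le_one).2 (by simp)
  nlinarith [norm_nonneg V]

theorem frob_isometry_mul {L : Type*} [Fintype L] [DecidableEq J] {V : Matrix I J ℂ}
    (hV : Vᴴ * V = 1) (A : Matrix J L ℂ) : frob (V * A) = frob A := by
  rw [← sq_eq_sq₀ (frob_nonneg _) (frob_nonneg _)]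
  have : (((frob (V * A)) ^ 2 : ℝ) : ℂ) = ((frob A ^ 2 : ℝ) : ℂ) := by
    rw [frob_sq_eq_trace, frob_sq_eq_trace, conjTranspose_mul, Matrix.mul_assoc,
      ← Matrix.mul_assoc Vᴴ, hV, Matrix.one_mul]
  exact_mod_cast this

theorem frob_mul_isometry {L : Type*} [Fintype L] [DecidableEq J] {V : Matrix I J ℂ}
    (hV : Vᴴ * V = 1) (A : Matrix L J ℂ) : frob (A * Vᴴ) = frob A := by
  rw [← frob_conjTranspose, conjTranspose_mul, conjTranspose_conjTranspose,
    frob_isometry_mul hV, frob_conjTranspose]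

end Frobenius

/-! ### Perturbation to exact unitaries and exact projections. -/

section Spectral

variable {I J : Type*} [Fintype I] [DecidableEq I] [Fintype J] [DecidableEq J]

theorem exists_spectral {A : Matrix I I ℂ} (hA : A.IsHermitian) :
    ∃ (W : Matrix I I ℂ) (μ : I → ℝ), Wᴴ * W = 1 ∧ W * Wᴴ = 1 ∧
      A = W * diagonal (fun i => (μ i : ℂ)) * Wᴴ := by
  refine ⟨hA.eigenvectorUnitary, hA.eigenvalues, ?_, ?_, ?_⟩
  · simpa [star_eq_conjTranspose] using Unitary.coe_star_mul_self hA.eigenvectorUnitary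
  · simpa [star_eq_conjTranspose] using Unitary.coe_mul_star_self hA.eigenvectorUnitary
  · conv_lhs => rw [hA.spectral_theorem]
    rw [Unitary.conjStarAlgAut_apply]
    rfl

/-- A square matrix is as close to the unitary group as `Aᴴ * A` is to the identity. -/
theorem exists_unitary_frob_sub_le (hIJ : Fintype.card I = Fintype.card J) (A : Matrix I J ℂ) :
    -- Diagonalizing `Aᴴ * A` by `W` makes the columns of `A * W` orthogonal. Normalizing them, and
    -- replacing zero columns by any orthonormal completion, gives the unitary up to `Wᴴ`.
    ∃ U : Matrix I J ℂ, Uᴴ * U = 1 ∧ U * Uᴴ = 1 ∧ frob (U - A) ≤ frob (Aᴴ * A - 1) := by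
  obtain ⟨W, μ, hW, hW', hA⟩ := exists_spectral (isHermitian_conjTranspose_mul_self A)
  set C := A * W with hC
  have hCC : Cᴴ * C = diagonal (fun i => (μ i : ℂ)) := by
    rw [hC, conjTranspose_mul, Matrix.mul_assoc, ← Matrix.mul_assoc Aᴴ, hA, Matrix.mul_assoc,
      Matrix.mul_assoc, hW, Matrix.mul_one, ← Matrix.mul_assoc, hW, Matrix.one_mul]
  let a : J → EuclideanSpace ℂ I := fun j => WithLp.toLp 2 (fun i => C i j)
  have hin : ∀ i j, inner ℂ (a i) (a j) = if i = j then (μ i : ℂ) else 0 := by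
    intro i j
    have := congrFun (congrFun hCC i) j
    rw [diagonal_apply] at this
    rw [← this]
    simp [a, Matrix.mul_apply, PiLp.inner_apply, mul_comm]
  have hna : ∀ j, ‖a j‖ ^ 2 = μ j := by
    intro j
    have h1 := hin j j
    rw [if_pos rfl, inner_self_eq_norm_sq_to_K] at h1
    apply Complex.ofReal_injective
    simpa using h1
  let v : J → EuclideanSpace ℂ I := fun j => ((‖a j‖⁻¹ : ℝ) : ℂ) • a j
  have hv : Orthonormal ℂ ({j | a j ≠ 0}.domRestrict v) := by
    constructor
    · rintro ⟨j, hj⟩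
      simp [v, norm_smul, inv_mul_cancel₀ (norm_ne_zero_iff.2 hj)]
    · rintro ⟨i, hi⟩ ⟨j, hj⟩ hij
      have hij' : i ≠ j := fun h => hij (by simp [h])
      simp [v, inner_smul_left, inner_smul_right, hin, hij']
  obtain ⟨b, hb⟩ := hv.exists_orthonormalBasis_extension_of_card_eq (by simp [hIJ])
  have hab : ∀ j, a j = (‖a j‖ : ℂ) • b j := by
    intro j
    by_cases hj : a j = 0
    · simp [hj]
    · rw [hb j hj]
      have : (‖a j‖ : ℂ) ≠ 0 := by simpa using hj
      simp [v, smul_smul, mul_inv_cancel₀ this]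
  let B : Matrix I J ℂ := Matrix.of fun i j => b j i
  have hB : Bᴴ * B = 1 := by
    ext i j
    have := orthonormal_iff_ite.1 b.orthonormal i j
    rw [one_apply, ← this]
    simp [B, Matrix.mul_apply, PiLp.inner_apply, mul_comm]
  have hBB : B * Bᴴ = 1 := by
    have e := Fintype.equivOfCardEq hIJ
    exact (Matrix.mul_eq_one_comm_of_equiv e.symm).1 hB
  refine ⟨B * Wᴴ, ?_, ?_, ?_⟩
  · rw [conjTranspose_mul, conjTranspose_conjTranspose, Matrix.mul_assoc, ← Matrix.mul_assoc Bᴴ,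
      hB, Matrix.one_mul, hW']
  · rw [conjTranspose_mul, conjTranspose_conjTranspose, Matrix.mul_assoc, ← Matrix.mul_assoc Wᴴ,
      hW, Matrix.one_mul, hBB]
  · have hA' : A = C * Wᴴ := by rw [hC, Matrix.mul_assoc, hW', Matrix.mul_one]
    have e1 : B * Wᴴ - A = (B - C) * Wᴴ := by rw [Matrix.sub_mul, ← hA']
    have e2 : Aᴴ * A - 1 = W * (diagonal (fun i => (μ i : ℂ)) - 1) * Wᴴ := by
      rw [Matrix.mul_sub, Matrix.sub_mul, ← hA, Matrix.mul_one, hW']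
    have e3 : diagonal (fun i => (μ i : ℂ)) - (1 : Matrix J J ℂ)
        = diagonal (fun i => (μ i : ℂ) - 1) := by
      rw [← diagonal_one, diagonal_sub]
    rw [e1, e2, frob_mul_isometry hW, frob_mul_isometry hW, frob_isometry_mul hW, e3,
      ← sq_le_sq₀ (frob_nonneg _) (frob_nonneg _), frob_diagonal_sq, frob_sq, Finset.sum_comm]
    refine Finset.sum_le_sum fun j _ => ?_
    have e4 : ∑ i, ‖(B - C) i j‖ ^ 2 = ‖b j - a j‖ ^ 2 := by
      rw [EuclideanSpace.norm_sq_eq]; rfl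
    have e5 : b j - a j = ((1 - ‖a j‖ : ℝ) : ℂ) • b j := by
      conv_lhs => rw [hab j]
      push_cast
      rw [sub_smul, one_smul]
    rw [e4, e5, norm_smul, b.norm_eq_one, mul_one, ← hna]
    rw [show ((‖a j‖ ^ 2 : ℝ) : ℂ) - 1 = ((‖a j‖ ^ 2 - 1 : ℝ) : ℂ) by push_cast; rfl,
      Complex.norm_real, Complex.norm_real, Real.norm_eq_abs, Real.norm_eq_abs, sq_abs, sq_abs]
    have := norm_nonneg (a j)
    -- The factor `1 + ‖a j‖` is at least `1`, so each column moves by no more than the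
    -- corresponding eigenvalue differs from `1`.
    have h3 : (‖a j‖ ^ 2 - 1) ^ 2 = (1 - ‖a j‖) ^ 2 * (1 + ‖a j‖) ^ 2 := by ring
    rw [h3]
    nlinarith [mul_nonneg (sq_nonneg (1 - ‖a j‖)) this,
      mul_nonneg (sq_nonneg (1 - ‖a j‖)) (sq_nonneg ‖a j‖)]

theorem frob_diagonal_indicator_sub_sq {S T : Finset I} (h : S ⊆ T) :
    frob (diagonal (fun i => if i ∈ S then (1 : ℂ) else 0)
      - diagonal (fun i => if i ∈ T then (1 : ℂ) else 0)) ^ 2 = (T.card : ℝ) - S.card := by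
  have : ∀ i, ‖(if i ∈ S then (1 : ℂ) else 0) - (if i ∈ T then (1 : ℂ) else 0)‖ ^ 2
      = (if i ∈ T then (1 : ℝ) else 0) - (if i ∈ S then (1 : ℝ) else 0) := by
    intro i
    by_cases h1 : i ∈ S
    · simp [h1, h h1]
    · by_cases h2 : i ∈ T <;> simp [h1, h2]
  rw [diagonal_sub, frob_diagonal_sq]
  simp_rw [this]
  simp

-- Comparability by inclusion makes the symmetric difference of `S` and `T` as small as the
-- cardinalities allow, so the distance of the two spectral projections is controlled by a trace.
omit [DecidableEq I] in
theorem exists_finset_card_eq_comparable (T : Finset I) {m : ℕ} (hm : m ≤ Fintype.card I) :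
    ∃ S : Finset I, S.card = m ∧ (S ⊆ T ∨ T ⊆ S) := by
  rcases le_total m T.card with h | h
  · obtain ⟨S, hS, hc⟩ := Finset.exists_subset_card_eq h
    exact ⟨S, hc, Or.inl hS⟩
  · obtain ⟨S, hS, -, hc⟩ := Finset.exists_subsuperset_card_eq (Finset.subset_univ T) h hm
    exact ⟨S, hc, Or.inr hS⟩

/-- A Hermitian matrix which is almost idempotent, of trace almost `m`, is close to a projection
of rank `m`. -/
theorem exists_isometry_frob_sub_le {h : Matrix I I ℂ} (hh : h.IsHermitian) {m : ℕ}
    (hm : m ≤ Fintype.card I) :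
    ∃ V : Matrix I (Fin m) ℂ, Vᴴ * V = 1 ∧
      frob (V * Vᴴ - h) ≤ √(‖(m : ℂ) - h.trace‖ + √(Fintype.card I) * (2 * frob (h * h - h)))
        + 2 * frob (h * h - h) := by
  obtain ⟨W, μ, hW, hW', hA⟩ := exists_spectral hh
  -- Cutting at `1 / 2` gives `|1_{μ > 1/2} - μ| ≤ 2 |μ ^ 2 - μ|`, the source of the constant `2`.
  -- The set `T` may have the wrong size and is then corrected to `S`, of cardinality exactly `m`.
  let T : Finset I := Finset.univ.filter fun i => 1 / 2 < μ i
  obtain ⟨S, hS, hST⟩ := exists_finset_card_eq_comparable T hm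
  let ind : Finset I → Matrix I I ℂ := fun S => diagonal (fun i => if i ∈ S then (1 : ℂ) else 0)
  let e : Fin m ≃ S := (S.equivFinOfCardEq hS).symm
  let V : Matrix I (Fin m) ℂ := W.submatrix id (fun a => (e a : I))
  have hV : Vᴴ * V = 1 := by
    ext a b
    have := congrFun (congrFun hW (e a)) (e b)
    rw [one_apply] at this ⊢
    simp only [EmbeddingLike.apply_eq_iff_eq, ← Subtype.ext_iff] at this
    rw [← this]
    simp [V, Matrix.mul_apply]
  have hVV : V * Vᴴ = W * ind S * Wᴴ := by
    ext i j
    have : ∑ a : Fin m, W i (e a) * star (W j (e a)) = ∑ s : S, W i s * star (W j s) :=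
      e.sum_comp (fun s : S => W i s * star (W j s))
    simp only [V, ind, Matrix.mul_apply, submatrix_apply, id, conjTranspose_apply, diagonal_apply]
    rw [this, Finset.sum_coe_sort S (fun s => W i s * star (W j s))]
    simp
  have hconj : ∀ D D' : Matrix I I ℂ,
      frob (W * D * Wᴴ - W * D' * Wᴴ) = frob (D - D') := by
    intro D D'
    rw [← Matrix.sub_mul, ← Matrix.mul_sub, frob_mul_isometry hW, frob_isometry_mul hW]
  set f := frob (h * h - h) with hf
  have hQ : frob (W * ind T * Wᴴ - h) ≤ 2 * f := by
    have e1 : h * h = W * (diagonal (fun i => (μ i : ℂ)) * diagonal (fun i => (μ i : ℂ))) * Wᴴ := by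
      conv_lhs => rw [hA]
      simp only [Matrix.mul_assoc]
      rw [← Matrix.mul_assoc Wᴴ W, hW, Matrix.one_mul]
    have e2 : f = frob (diagonal (fun i => ((μ i : ℂ) * μ i - μ i))) := by
      rw [hf, e1]
      conv_lhs => rw [hA]
      rw [hconj, diagonal_mul_diagonal, diagonal_sub]
    conv_lhs => rw [hA]
    rw [hconj, e2, ← sq_le_sq₀ (frob_nonneg _) (mul_nonneg zero_le_two (frob_nonneg _)), mul_pow,
      diagonal_sub, frob_diagonal_sq, frob_diagonal_sq, Finset.mul_sum]
    refine Finset.sum_le_sum fun i _ => ?_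
    rw [show (μ i : ℂ) * μ i - μ i = ((μ i * μ i - μ i : ℝ) : ℂ) by push_cast; rfl,
      Complex.norm_real, Real.norm_eq_abs, sq_abs]
    by_cases hi : 1 / 2 < μ i
    · have : i ∈ T := Finset.mem_filter.2 ⟨Finset.mem_univ i, hi⟩
      rw [if_pos this, ← Complex.ofReal_one, ← Complex.ofReal_sub, Complex.norm_real,
        Real.norm_eq_abs, sq_abs]
      nlinarith [mul_nonneg (sq_nonneg (1 - μ i)) (by nlinarith : (0 : ℝ) ≤ (2 * μ i) ^ 2 - 1)]
    · have : i ∉ T := fun h => hi (Finset.mem_filter.1 h).2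
      rw [if_neg this, zero_sub, norm_neg, Complex.norm_real, Real.norm_eq_abs, sq_abs]
      have h3 : μ i ≤ 1 / 2 := not_lt.1 hi
      nlinarith [mul_nonneg (sq_nonneg (μ i)) (by nlinarith : (0 : ℝ) ≤ (2 * (1 - μ i)) ^ 2 - 1)]
  have htr : (W * ind T * Wᴴ).trace = T.card := by
    rw [trace_mul_comm, ← Matrix.mul_assoc, hW, Matrix.one_mul]
    simp [ind, trace_diagonal]
  -- The cardinality of `T` is the trace of a projection close to `h`, and Cauchy–Schwarz compares
  -- the two traces.
  have hcard : |(m : ℝ) - T.card| ≤ ‖(m : ℂ) - h.trace‖ + √(Fintype.card I) * (2 * f) := by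
    have e3 : |(m : ℝ) - T.card| = ‖(m : ℂ) - T.card‖ := by
      rw [← Real.norm_eq_abs, ← Complex.norm_real]
      push_cast
      rfl
    rw [e3]
    calc ‖(m : ℂ) - T.card‖ ≤ ‖(m : ℂ) - h.trace‖ + ‖h.trace - T.card‖ :=
          norm_sub_le_norm_sub_add_norm_sub _ _ _
      _ ≤ _ := by
        gcongr
        rw [← htr, ← Matrix.trace_sub, ← norm_neg, ← Matrix.trace_neg, neg_sub]
        exact (norm_trace_le _).trans (by gcongr)
  have hPQ : frob (W * ind S * Wᴴ - W * ind T * Wᴴ) ^ 2 = |(m : ℝ) - T.card| := by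
    rw [hconj]
    rcases hST with h1 | h1
    · have := Finset.card_le_card h1
      rw [frob_diagonal_indicator_sub_sq h1, abs_sub_comm, abs_of_nonneg, hS]
      rw [hS] at this
      simpa using this
    · have := Finset.card_le_card h1
      rw [frob_sub_comm, frob_diagonal_indicator_sub_sq h1, abs_of_nonneg, hS]
      rw [hS] at this
      simpa using this
  refine ⟨V, hV, ?_⟩
  rw [hVV]
  refine (frob_sub_le _ (W * ind T * Wᴴ) _).trans (add_le_add ?_ hQ)
  exact Real.le_sqrt_of_sq_le (hPQ.le.trans hcard)

end Spectral

/-! ### Passing between matrix entries and their self-adjoint parts. -/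

section EntryParts

variable {A : Type*} [Ring A] [Algebra ℂ A] {n N : ℕ}

/-- `entryParts`, with the adjoint of the `(i, j)` entry replaced by the `(j, i)` entry. -/
def symParts (X : Fin n → Fin N → Fin N → A) : Fin n × Fin N × Fin N → A :=
  fun p =>
    if p.2.2 ≤ p.2.1 then (1 / 2 : ℂ) • (X p.1 p.2.1 p.2.2 + X p.1 p.2.2 p.2.1)
    else (1 / (2 * Complex.I) : ℂ) • (X p.1 p.2.1 p.2.2 - X p.1 p.2.2 p.2.1)

/-- The entries `X_{ij}^k` in terms of the family `Y_{ij}^k`. -/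
def ofParts (y : Fin n × Fin N × Fin N → A) : Fin n → Fin N → Fin N → A :=
  fun k i j =>
    if i = j then y (k, i, i)
    else if j < i then y (k, i, j) - Complex.I • y (k, j, i)
    else y (k, j, i) + Complex.I • y (k, i, j)

theorem ofParts_symParts (X : Fin n → Fin N → Fin N → A) : ofParts (symParts X) = X := by
  have e : ∀ a b : A, Complex.I • (1 / (2 * Complex.I) : ℂ) • (a - b) = (1 / 2 : ℂ) • (a - b) := by
    intro a b
    rw [smul_smul]
    congr 1
    field_simp
  funext k i j
  rcases lt_trichotomy i j with h | h | h
  · simp only [ofParts, symParts, h.ne, h.not_gt, h.not_ge, h.le, if_true, if_false, e]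
    module
  · subst h
    simp only [ofParts, symParts, le_refl, if_true]
    module
  · simp only [ofParts, symParts, h.ne', h, h.not_ge, h.le, if_true, if_false, e]
    module

theorem map_ofParts {A' : Type*} [Ring A'] [Algebra ℂ A'] (f : A →ₐ[ℂ] A')
    (y : Fin n × Fin N × Fin N → A) (k : Fin n) (i j : Fin N) :
    f (ofParts y k i j) = ofParts (fun p => f (y p)) k i j := by
  simp only [ofParts]
  split_ifs <;> simp

theorem map_symParts {A' : Type*} [Ring A'] [Algebra ℂ A'] (f : A →ₐ[ℂ] A')
    (X : Fin n → Fin N → Fin N → A) (p : Fin n × Fin N × Fin N) :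
    f (symParts X p) = symParts (fun k i j => f (X k i j)) p := by
  simp only [symParts]
  split_ifs <;> simp

variable [StarRing A]

theorem entryParts_eq_symParts {X : Fin n → Fin N → Fin N → A}
    (hX : ∀ k i j, X k i j = star (X k j i)) : entryParts X = symParts X := by
  funext p
  simp only [entryParts, symParts, ← hX]

theorem ofParts_entryParts {X : Fin n → Fin N → Fin N → A}
    (hX : ∀ k i j, X k i j = star (X k j i)) : ofParts (entryParts X) = X := by
  rw [entryParts_eq_symParts hX, ofParts_symParts]

theorem isSelfAdjoint_entryParts [StarModule ℂ A] (X : Fin n → Fin N → Fin N → A)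
    (p : Fin n × Fin N × Fin N) : IsSelfAdjoint (entryParts X p) := by
  simp only [entryParts, IsSelfAdjoint]
  split_ifs
  · simp [star_smul, add_comm]
  · rw [star_smul, star_sub, star_star, ← neg_sub, smul_neg, ← neg_smul]
    congr 1
    simp

theorem entryParts_mem {B : Subalgebra ℂ A} {X : Fin n → Fin N → Fin N → A}
    (hX : ∀ k i j, X k i j = star (X k j i)) (hB : ∀ k i j, X k i j ∈ B)
    (p : Fin n × Fin N × Fin N) : entryParts X p ∈ B := by
  rw [entryParts_eq_symParts hX]
  simp only [symParts]
  split_ifs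
  · exact B.smul_mem (B.add_mem (hB _ _ _) (hB _ _ _)) _
  · exact B.smul_mem (B.sub_mem (hB _ _ _) (hB _ _ _)) _

end EntryParts

/-! ### Block decompositions along frames. -/

section Frame

variable {N m k : ℕ}

/-- A decomposition of `ℂ ^ k` as an orthogonal sum of `N` copies of `ℂ ^ m`. -/
structure IsFrame (U : Fin N → Matrix (Fin k) (Fin m) ℂ) : Prop where
  conjTranspose_mul : ∀ i j, (U i)ᴴ * U j = if i = j then 1 else 0
  sum_mul_conjTranspose : ∑ i, U i * (U i)ᴴ = 1

/-- The blocks of a matrix along a frame. -/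
def compress (U : Fin N → Matrix (Fin k) (Fin m) ℂ) (z : Matrix (Fin k) (Fin k) ℂ)
    (i j : Fin N) : Matrix (Fin m) (Fin m) ℂ :=
  (U i)ᴴ * z * U j

/-- The matrix with given blocks along a frame. -/
def assemble (U : Fin N → Matrix (Fin k) (Fin m) ℂ)
    (a : Matrix (Fin N) (Fin N) (Matrix (Fin m) (Fin m) ℂ)) : Matrix (Fin k) (Fin k) ℂ :=
  ∑ i, ∑ j, U i * a i j * (U j)ᴴ

variable {U : Fin N → Matrix (Fin k) (Fin m) ℂ}

theorem IsFrame.norm_le_one (hU : IsFrame U) (i : Fin N) : ‖U i‖ ≤ 1 :=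
  norm_le_one_of_isometry (by rw [hU.conjTranspose_mul, if_pos rfl])

theorem conjTranspose_compress (z : Matrix (Fin k) (Fin k) ℂ) (i j : Fin N) :
    (compress U z i j)ᴴ = compress U zᴴ j i := by
  simp [compress, Matrix.mul_assoc]

theorem IsFrame.norm_compress_le (hU : IsFrame U) (z : Matrix (Fin k) (Fin k) ℂ) (i j : Fin N) :
    ‖compress U z i j‖ ≤ ‖z‖ := by
  have h1 : ‖(U i)ᴴ‖ ≤ 1 := by rw [l2_opNorm_conjTranspose]; exact hU.norm_le_one i
  calc ‖compress U z i j‖ ≤ ‖(U i)ᴴ * z‖ * ‖U j‖ := l2_opNorm_mul _ _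
    _ ≤ ‖(U i)ᴴ‖ * ‖z‖ * ‖U j‖ := by gcongr; exact l2_opNorm_mul _ _
    _ ≤ 1 * ‖z‖ * 1 := by gcongr; exact hU.norm_le_one j
    _ = ‖z‖ := by ring

/-- The triangle inequality over the `N ^ 2` blocks is wasteful but sufficient, because the entropy
is a supremum over all cut-offs `R`. -/
theorem IsFrame.norm_assemble_le (hU : IsFrame U)
    (a : Matrix (Fin N) (Fin N) (Matrix (Fin m) (Fin m) ℂ)) {C : ℝ} (hC : ∀ i j, ‖a i j‖ ≤ C) :
    ‖assemble U a‖ ≤ N * (N * C) := by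
  have h : ∀ i j, ‖U i * a i j * (U j)ᴴ‖ ≤ C := by
    intro i j
    have h1 : ‖(U j)ᴴ‖ ≤ 1 := by rw [l2_opNorm_conjTranspose]; exact hU.norm_le_one j
    calc _ ≤ ‖U i * a i j‖ * ‖(U j)ᴴ‖ := l2_opNorm_mul _ _
      _ ≤ ‖U i‖ * ‖a i j‖ * ‖(U j)ᴴ‖ := by gcongr; exact l2_opNorm_mul _ _
      _ ≤ 1 * ‖a i j‖ * 1 := by gcongr; exact hU.norm_le_one i
      _ ≤ C := by simpa using hC i j
  calc ‖assemble U a‖ ≤ ∑ i : Fin N, ∑ j : Fin N, C :=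
        norm_sum_le_of_le _ fun i _ => norm_sum_le_of_le _ fun j _ => h i j
    _ = N * (N * C) := by simp

theorem IsFrame.assemble_compress (hU : IsFrame U) (z : Matrix (Fin k) (Fin k) ℂ) :
    assemble U (Matrix.of (compress U z)) = z := by
  have h : assemble U (Matrix.of (compress U z))
      = (∑ i, U i * (U i)ᴴ) * z * ∑ j, U j * (U j)ᴴ := by
    simp only [assemble, compress, Matrix.sum_mul, Matrix.mul_sum, Matrix.of_apply,
      Matrix.mul_assoc]
    rw [Finset.sum_comm]
  rw [h, hU.sum_mul_conjTranspose, Matrix.one_mul, Matrix.mul_one]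

theorem IsFrame.compress_assemble (hU : IsFrame U)
    (a : Matrix (Fin N) (Fin N) (Matrix (Fin m) (Fin m) ℂ)) (i j : Fin N) :
    compress U (assemble U a) i j = a i j := by
  have h : ∀ p q, (U i)ᴴ * (U p * a p q * (U q)ᴴ) * U j
      = if i = p then (if q = j then a i j else 0) else 0 := by
    intro p q
    have : (U i)ᴴ * (U p * a p q * (U q)ᴴ) * U j = ((U i)ᴴ * U p) * a p q * ((U q)ᴴ * U j) := by
      simp only [Matrix.mul_assoc]
    rw [this, hU.conjTranspose_mul, hU.conjTranspose_mul]
    split_ifs with h1 h2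
    · subst h1 h2; simp
    all_goals simp
  simp only [compress, assemble, Matrix.mul_sum, Matrix.sum_mul, h]
  simp

theorem IsFrame.assemble_mul (hU : IsFrame U)
    (a b : Matrix (Fin N) (Fin N) (Matrix (Fin m) (Fin m) ℂ)) :
    assemble U (a * b) = assemble U a * assemble U b := by
  have h : ∀ i j, compress U (assemble U a * assemble U b) i j = (a * b) i j := by
    intro i j
    rw [compress, ← Matrix.mul_one (assemble U a), ← hU.sum_mul_conjTranspose, Matrix.mul_sum,
      Matrix.sum_mul, Matrix.mul_sum, Matrix.sum_mul, Matrix.mul_apply]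
    refine Finset.sum_congr rfl fun p _ => ?_
    rw [← hU.compress_assemble a i p, ← hU.compress_assemble b p j]
    simp only [compress, Matrix.mul_assoc]
  rw [← hU.assemble_compress (assemble U a * assemble U b)]
  congr 1
  ext1 i j
  exact (h i j).symm

theorem IsFrame.assemble_one (hU : IsFrame U) : assemble U 1 = 1 := by
  rw [← hU.sum_mul_conjTranspose, assemble]
  refine Finset.sum_congr rfl fun i _ => ?_
  rw [Finset.sum_eq_single i] <;> simp +contextual [one_apply, eq_comm]

theorem IsFrame.trace_assemble (hU : IsFrame U)
    (a : Matrix (Fin N) (Fin N) (Matrix (Fin m) (Fin m) ℂ)) :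
    (assemble U a).trace = a.trace.trace := by
  simp only [assemble, trace_sum]
  have : ∀ i j, (U i * a i j * (U j)ᴴ).trace = if j = i then (a i i).trace else 0 := by
    intro i j
    rw [Matrix.trace_mul_comm, ← Matrix.mul_assoc, hU.conjTranspose_mul]
    split_ifs with h
    · subst h; simp
    · simp
  have htr : a.trace = ∑ i, a i i := rfl
  simp [this, htr, trace_sum]

theorem conjTranspose_assemble (a : Matrix (Fin N) (Fin N) (Matrix (Fin m) (Fin m) ℂ)) :
    (assemble U a)ᴴ = assemble U aᴴ := by
  simp only [assemble, conjTranspose_sum, conjTranspose_mul, conjTranspose_conjTranspose]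
  rw [Finset.sum_comm]
  simp only [Matrix.mul_assoc, conjTranspose_apply, star_eq_conjTranspose]

theorem IsFrame.sum_trace_compress_mul (hU : IsFrame U) (z : Matrix (Fin k) (Fin k) ℂ) :
    ∑ i, ∑ j, (compress U z i j * compress U z j i).trace = (z * z).trace := by
  conv_rhs => rw [← hU.assemble_compress z, ← hU.assemble_mul, hU.trace_assemble]
  have htr : (Matrix.of (compress U z) * Matrix.of (compress U z)).trace
      = ∑ i, ∑ j, compress U z i j * compress U z j i :=
    Finset.sum_congr rfl fun i _ => by simp [Matrix.mul_apply]
  simp [htr, trace_sum]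

/-- The columns of a unitary, grouped by their first index, are the isometries of a frame. -/
theorem isFrame_of_unitary {W : Matrix (Fin k) (Fin N × Fin m) ℂ} (h : Wᴴ * W = 1)
    (h' : W * Wᴴ = 1) : IsFrame fun i => W.submatrix id (fun a => (i, a)) where
  conjTranspose_mul i j := by
    ext a b
    have := congrFun (congrFun h (i, a)) (j, b)
    rw [one_apply, Matrix.mul_apply] at this
    rw [Matrix.mul_apply]
    refine Eq.trans (by simp) (this.trans ?_)
    by_cases hij : i = j <;> simp [hij, one_apply]
  sum_mul_conjTranspose := by
    rw [← h']
    ext r s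
    simp [Matrix.sum_apply, Matrix.mul_apply, Fintype.sum_prod_type]

theorem exists_isFrame (N m : ℕ) : ∃ U : Fin N → Matrix (Fin (N * m)) (Fin m) ℂ, IsFrame U := by
  refine ⟨_, isFrame_of_unitary
    (W := (1 : Matrix (Fin (N * m)) (Fin (N * m)) ℂ).submatrix id finProdFinEquiv) ?_ ?_⟩
  · rw [conjTranspose_submatrix, conjTranspose_one,
      ← submatrix_mul _ _ _ id _ Function.bijective_id]
    simp
  · rw [conjTranspose_submatrix, conjTranspose_one,
      ← submatrix_mul _ _ _ _ _ finProdFinEquiv.bijective]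
    simp

end Frame

/-! ### Lebesgue measure under scaled isometries, and coordinates. -/

section Volume

/-- A linear map which is isometric after rescaling the coordinates rescales Lebesgue measure. -/
theorem volume_preimage_of_scaled_isometry {I J : Type*} [Fintype I] [Fintype J]
    (L : (I → ℝ) →ₗ[ℝ] (J → ℝ)) (hIJ : Fintype.card I = Fintype.card J) (a : J → ℝ)
    (ha : ∀ j, 0 < a j) (hL : ∀ c, ∑ j, (a j * L c j) ^ 2 = ∑ i, c i ^ 2) (S : Set (J → ℝ)) :
    volume (L ⁻¹' S) = ENNReal.ofReal (∏ j, a j) * volume S := by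
  classical
  let D : (J → ℝ) →ₗ[ℝ] (J → ℝ) := Matrix.toLin' (diagonal a)
  have hD : ∀ c j, D c j = a j * c j := fun c j => by simp [D, mulVec_diagonal]
  have hDinj : Function.Injective D := by
    intro c d h
    funext j
    have := congrFun h j
    rw [hD, hD] at this
    exact mul_left_cancel₀ (ha j).ne' this
  let T : EuclideanSpace ℝ I →ₗᵢ[ℝ] EuclideanSpace ℝ J :=
    { toLinearMap := (WithLp.linearEquiv 2 ℝ (J → ℝ)).symm.toLinearMap ∘ₗ D ∘ₗ L ∘ₗ
        (WithLp.linearEquiv 2 ℝ (I → ℝ)).toLinearMap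
      norm_map' := by
        intro c
        rw [← sq_eq_sq₀ (norm_nonneg _) (norm_nonneg _), EuclideanSpace.norm_sq_eq,
          EuclideanSpace.norm_sq_eq]
        simpa [hD, mul_pow] using hL (WithLp.ofLp c) }
  let Te : EuclideanSpace ℝ I ≃ₗᵢ[ℝ] EuclideanSpace ℝ J :=
    T.toLinearIsometryEquiv (by simp [hIJ])
  have hmp : MeasurePreserving (fun c : I → ℝ => D (L c)) :=
    (PiLp.volume_preserving_ofLp J).comp
      (Te.measurePreserving.comp (PiLp.volume_preserving_toLp I))
  have hemb : MeasurableEmbedding (fun c : I → ℝ => D (L c)) :=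
    (MeasurableEquiv.toLp 2 (J → ℝ)).symm.measurableEmbedding.comp
      (Te.toMeasurableEquiv.measurableEmbedding.comp
        (MeasurableEquiv.toLp 2 (I → ℝ)).measurableEmbedding)
  -- The composite of `D` and `L` preserves volume, so the preimage of `S` has the volume of `D ''
  -- S`, and the determinant of `D` is the product of the scales.
  have h1 : L ⁻¹' S = (fun c : I → ℝ => D (L c)) ⁻¹' (D '' S) := by
    ext c
    simp [hDinj.eq_iff]
  rw [h1, hmp.measure_preimage_emb hemb, Measure.addHaar_image_linearMap]
  congr 2
  rw [LinearMap.det_toLin', det_diagonal, abs_of_pos (Finset.prod_pos fun j _ => ha j)]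

/-- Flattening of triply indexed families. -/
def uncurry₃ (ι κ κ' : Type*) : (ι → κ → κ' → ℝ) ≃ᵐ (ι × κ × κ' → ℝ) where
  toFun c p := c p.1 p.2.1 p.2.2
  invFun c i j k := c (i, j, k)
  left_inv _ := rfl
  right_inv _ := rfl
  measurable_toFun := by
    refine measurable_pi_lambda _ fun p => ?_
    exact (measurable_pi_apply p.2.2).comp
      ((measurable_pi_apply p.2.1).comp (measurable_pi_apply p.1))
  measurable_invFun := by
    refine measurable_pi_lambda _ fun i => measurable_pi_lambda _ fun j =>
      measurable_pi_lambda _ fun k => ?_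
    exact measurable_pi_apply (i, j, k)

theorem measurePreserving_uncurry₃ (ι κ κ' : Type*) [Fintype ι] [Fintype κ] [Fintype κ'] :
    MeasurePreserving (uncurry₃ ι κ κ') := by
  refine ⟨(uncurry₃ ι κ κ').measurable, ?_⟩
  refine (Measure.pi_eq fun s hs => ?_).symm
  have : (uncurry₃ ι κ κ') ⁻¹' Set.univ.pi s
      = Set.univ.pi fun i => Set.univ.pi fun j => Set.univ.pi fun k => s (i, j, k) := by
    ext c
    simp only [Set.mem_preimage, Set.mem_pi, Set.mem_univ, forall_true_left]
    exact ⟨fun h i j k => h (i, j, k), fun h p => h p.1 p.2.1 p.2.2⟩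
  rw [(uncurry₃ ι κ κ').map_apply, this]
  simp only [volume_pi_pi, Fintype.prod_prod_type]

end Volume

section Coordinates

variable {k : ℕ}

/-- The coordinates of a self-adjoint matrix with respect to `hermOfCoords`. -/
def coordsOfHerm (x : Matrix (Fin k) (Fin k) ℂ) : Fin k → Fin k → ℝ :=
  fun i j => if i = j then (x i i).re else if i < j then √2 * (x i j).re else √2 * (x j i).im

theorem hermOfCoords_coordsOfHerm {x : Matrix (Fin k) (Fin k) ℂ} (hx : x.IsHermitian) :
    hermOfCoords (coordsOfHerm x) = x := by
  have h2 : ((√2 : ℝ) : ℂ) ≠ 0 := by simp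
  ext i j
  have hs : ∀ i j, star (x j i) = x i j := fun i j => hx.apply i j
  rcases lt_trichotomy i j with h | h | h
  · simp only [hermOfCoords, coordsOfHerm, Matrix.of_apply, h.ne, h.ne', h, h.not_gt, if_true,
      if_false]
    rw [div_eq_iff h2]
    apply Complex.ext <;> simp [mul_comm]
  · subst h
    have := congrArg Complex.im (hs i i)
    simp at this
    apply Complex.ext
    · simp [hermOfCoords, coordsOfHerm]
    · simp [hermOfCoords, coordsOfHerm]; linarith
  · simp only [hermOfCoords, coordsOfHerm, Matrix.of_apply, h.ne, h.ne', h, h.not_gt, if_true,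
      if_false]
    rw [div_eq_iff h2, ← hs i j]
    apply Complex.ext <;> simp [mul_comm]

theorem sum_sq_coordsOfHerm {x : Matrix (Fin k) (Fin k) ℂ} (hx : x.IsHermitian) :
    ((∑ i, ∑ j, coordsOfHerm x i j ^ 2 : ℝ) : ℂ) = (x * x).trace := by
  have h := trace_hermOfCoords_mul (coordsOfHerm x) (coordsOfHerm x)
  rw [hermOfCoords_coordsOfHerm hx] at h
  rw [h]
  simp only [sq]

theorem hermOfCoords_add (c d : Fin k → Fin k → ℝ) :
    hermOfCoords (c + d) = hermOfCoords c + hermOfCoords d := by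
  ext i j
  simp only [hermOfCoords, Matrix.of_apply, Matrix.add_apply, Pi.add_apply]
  split_ifs <;> push_cast <;> ring

theorem hermOfCoords_smul (r : ℝ) (c : Fin k → Fin k → ℝ) :
    hermOfCoords (r • c) = (r : ℂ) • hermOfCoords c := by
  ext i j
  simp only [hermOfCoords, Matrix.of_apply, Matrix.smul_apply, Pi.smul_apply, smul_eq_mul]
  split_ifs <;> push_cast <;> ring

theorem coordsOfHerm_add (x y : Matrix (Fin k) (Fin k) ℂ) :
    coordsOfHerm (x + y) = coordsOfHerm x + coordsOfHerm y := by
  ext i j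
  simp only [coordsOfHerm, Matrix.add_apply, Pi.add_apply, Complex.add_re, Complex.add_im]
  split_ifs <;> ring

theorem coordsOfHerm_smul (r : ℝ) (x : Matrix (Fin k) (Fin k) ℂ) :
    coordsOfHerm ((r : ℂ) • x) = r • coordsOfHerm x := by
  ext i j
  simp only [coordsOfHerm, Matrix.smul_apply, Pi.smul_apply, smul_eq_mul, Complex.re_ofReal_mul,
    Complex.im_ofReal_mul]
  split_ifs <;> ring

end Coordinates

/-! ### The Jacobian of the passage to self-adjoint parts of blocks. -/

section ChangeOfVariables

variable {n N m k : ℕ}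

/-- The self-adjoint parts of the blocks of a tuple of matrices along a frame. -/
def blockParts (U : Fin N → Matrix (Fin k) (Fin m) ℂ) (z : Fin n → Matrix (Fin k) (Fin k) ℂ) :
    Fin n × Fin N × Fin N → Matrix (Fin m) (Fin m) ℂ :=
  symParts fun a => compress U (z a)

theorem compress_eq_star {U : Fin N → Matrix (Fin k) (Fin m) ℂ} {z : Matrix (Fin k) (Fin k) ℂ}
    (hz : z.IsHermitian) (i j : Fin N) : compress U z i j = star (compress U z j i) := by
  rw [star_eq_conjTranspose, conjTranspose_compress, hz.eq]

theorem blockParts_eq_entryParts {U : Fin N → Matrix (Fin k) (Fin m) ℂ}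
    {z : Fin n → Matrix (Fin k) (Fin k) ℂ} (hz : ∀ a, (z a).IsHermitian) :
    blockParts U z = entryParts fun a => compress U (z a) :=
  (entryParts_eq_symParts fun a i j => compress_eq_star (hz a) i j).symm

theorem isHermitian_blockParts {U : Fin N → Matrix (Fin k) (Fin m) ℂ}
    {z : Fin n → Matrix (Fin k) (Fin k) ℂ} (hz : ∀ a, (z a).IsHermitian)
    (p : Fin n × Fin N × Fin N) : (blockParts U z p).IsHermitian := by
  rw [blockParts_eq_entryParts hz]
  exact isSelfAdjoint_entryParts _ p

theorem blockParts_add (U : Fin N → Matrix (Fin k) (Fin m) ℂ)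
    (z w : Fin n → Matrix (Fin k) (Fin k) ℂ) :
    blockParts U (z + w) = blockParts U z + blockParts U w := by
  funext p
  simp only [blockParts, symParts, compress, Pi.add_apply, Matrix.mul_add, Matrix.add_mul]
  split_ifs <;> module

theorem blockParts_smul (U : Fin N → Matrix (Fin k) (Fin m) ℂ) (c : ℂ)
    (z : Fin n → Matrix (Fin k) (Fin k) ℂ) : blockParts U (c • z) = c • blockParts U z := by
  funext p
  simp only [blockParts, symParts, compress, Pi.smul_apply, Matrix.mul_smul, Matrix.smul_mul]
  split_ifs <;> module

/-- The factors by which the coordinates of the blocks have to be scaled to get an isometry. -/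
def blockScale (i j : Fin N) : ℝ := if i = j then 1 else √2

/-- For `i ≠ j` the two blocks are `a ± √-1 b`, and `x_ij x_ji + x_ji x_ij` has trace `2 Tr (a ^ 2 +
b ^ 2)`, whence the weight `√2 ^ 2`. The identity fails term by term and holds after pairing `(i,
j)` with `(j, i)`. -/
theorem IsFrame.sum_trace_blockParts_sq {U : Fin N → Matrix (Fin k) (Fin m) ℂ} (hU : IsFrame U)
    (z : Fin n → Matrix (Fin k) (Fin k) ℂ) (a : Fin n) :
    ∑ i, ∑ j, ((blockScale i j ^ 2 : ℝ) : ℂ) *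
        (blockParts U z (a, i, j) * blockParts U z (a, i, j)).trace = (z a * z a).trace := by
  rw [← hU.sum_trace_compress_mul]
  set x := compress U (z a) with hx
  set f : Fin N → Fin N → ℂ := fun i j => ((blockScale i j ^ 2 : ℝ) : ℂ) *
        (blockParts U z (a, i, j) * blockParts U z (a, i, j)).trace with hf
  set g : Fin N → Fin N → ℂ := fun i j => (x i j * x j i).trace with hg
  have hI : Complex.I⁻¹ ^ 2 = -1 := by simp
  have key : ∀ i j, i < j → f i j + f j i = g i j + g j i := by
    intro i j h
    have h2 : (√2 : ℝ) ^ 2 = 2 := Real.sq_sqrt (by norm_num)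
    simp only [hf, hg, blockScale, h.ne, h.ne', if_false, h2, blockParts, symParts, h.le,
      h.not_ge, if_true, Matrix.smul_mul, Matrix.mul_smul, trace_smul,
      Matrix.add_mul, Matrix.mul_add, Matrix.sub_mul, Matrix.mul_sub, trace_add, trace_sub,
      smul_eq_mul, ← hx]
    push_cast
    linear_combination (1 / 2 * ((x i j * x i j).trace - (x j i * x i j).trace
      - (x i j * x j i).trace + (x j i * x j i).trace)) * hI
  have key' : ∀ i j, f i j + f j i = g i j + g j i := by
    intro i j
    rcases lt_trichotomy i j with h | h | h
    · exact key i j h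
    · subst h
      have : f i i = g i i := by
        simp only [hf, hg, blockScale, if_true, blockParts, symParts, le_refl, ← hx]
        rw [← two_smul ℂ (x i i), smul_smul]
        norm_num
      rw [this]
    · rw [add_comm, key j i h, add_comm]
  have h2 : ∀ F : Fin N → Fin N → ℂ, 2 * ∑ i, ∑ j, F i j = ∑ i, ∑ j, (F i j + F j i) := by
    intro F
    simp only [Finset.sum_add_distrib]
    rw [Finset.sum_comm (f := fun i j => F j i)]
    ring
  refine mul_left_cancel₀ (two_ne_zero (α := ℂ)) ?_
  rw [h2 f, h2 g]
  simp only [key']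

/-- There are `n N (N - 1)` off-diagonal parts, each carrying `m ^ 2` real coordinates. -/
theorem prod_blockScale (n N m : ℕ) :
    ∏ q : (Fin n × Fin N × Fin N) × Fin m × Fin m, blockScale q.1.2.1 q.1.2.2
      = √2 ^ (n * (N * (N - 1)) * m ^ 2) := by
  have h : ∀ i : Fin N, ∏ j : Fin N, blockScale i j = √2 ^ (N - 1) := by
    intro i
    rw [← Finset.mul_prod_erase _ _ (Finset.mem_univ i)]
    rw [Finset.prod_congr rfl (g := fun _ => √2) (fun j hj => by
      rw [blockScale, if_neg (Finset.ne_of_mem_erase hj).symm])]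
    simp [blockScale]
  simp only [Fintype.prod_prod_type, Finset.prod_const, Finset.card_univ, Fintype.card_fin,
    Fintype.card_prod,
    Finset.prod_pow, h, ← pow_mul]
  congr 1
  ring

/-- The change of variables from a tuple of `k × k` matrices to the self-adjoint parts of its
blocks. -/
theorem IsFrame.lebesgue_preimage_blockParts {U : Fin N → Matrix (Fin k) (Fin m) ℂ}
    (hU : IsFrame U) (hk : k = N * m)
    (S : Set (Fin n × Fin N × Fin N → Matrix (Fin m) (Fin m) ℂ)) :
    lebesgue (blockParts U ⁻¹' S)
      = ENNReal.ofReal (√2 ^ (n * (N * (N - 1)) * m ^ 2)) * lebesgue S := by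
  let Φ : (Fin n × Fin k × Fin k → ℝ) → Fin n × Fin N × Fin N → Fin m → Fin m → ℝ :=
    fun c p => coordsOfHerm
      (blockParts U (fun a => hermOfCoords ((uncurry₃ _ _ _).symm c a)) p)
  let L : (Fin n × Fin k × Fin k → ℝ) →ₗ[ℝ] ((Fin n × Fin N × Fin N) × Fin m × Fin m → ℝ) :=
    { toFun := fun c => uncurry₃ _ _ _ (Φ c)
      map_add' := by
        intro c d
        have : (fun a => hermOfCoords ((uncurry₃ (Fin n) (Fin k) (Fin k)).symm (c + d) a))
            = (fun a => hermOfCoords ((uncurry₃ _ _ _).symm c a))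
              + fun a => hermOfCoords ((uncurry₃ _ _ _).symm d a) := by
          funext a
          exact hermOfCoords_add _ _
        funext q
        simp only [Φ]
        rw [this, blockParts_add]
        change coordsOfHerm (_ + _) _ _ = _
        rw [coordsOfHerm_add]
        rfl
      map_smul' := by
        intro r c
        have : (fun a => hermOfCoords ((uncurry₃ (Fin n) (Fin k) (Fin k)).symm (r • c) a))
            = (r : ℂ) • (fun a => hermOfCoords ((uncurry₃ _ _ _).symm c a)) := by
          funext a
          exact hermOfCoords_smul _ _
        funext q
        simp only [Φ]
        rw [this, blockParts_smul]
        change coordsOfHerm ((r : ℂ) • _) _ _ = _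
        rw [coordsOfHerm_smul]
        rfl }
  have hherm : ∀ c : Fin n × Fin k × Fin k → ℝ, ∀ a,
      (hermOfCoords ((uncurry₃ _ _ _).symm c a)).IsHermitian :=
    fun c a => isHermitian_hermOfCoords _
  have hL := volume_preimage_of_scaled_isometry L (by simp [hk]; ring)
    (fun q => blockScale q.1.2.1 q.1.2.2)
    (fun q => by unfold blockScale; split_ifs <;> positivity) (by
      intro c
      apply Complex.ofReal_injective
      have h1 : ∑ i, c i ^ 2 = ∑ a : Fin n, ∑ r, ∑ s, c (a, r, s) ^ 2 := by
        simp only [Fintype.sum_prod_type]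
      have h2 : ∀ a : Fin n, ((∑ r, ∑ s, c (a, r, s) ^ 2 : ℝ) : ℂ)
          = (hermOfCoords ((uncurry₃ _ _ _).symm c a)
              * hermOfCoords ((uncurry₃ _ _ _).symm c a)).trace := by
        intro a
        rw [trace_hermOfCoords_mul]
        simp only [sq]
        rfl
      rw [h1, Complex.ofReal_sum (f := fun a => ∑ r, ∑ s, c (a, r, s) ^ 2),
        Finset.sum_congr rfl fun a _ => (h2 a).trans
        (hU.sum_trace_blockParts_sq (fun a => hermOfCoords ((uncurry₃ _ _ _).symm c a)) a).symm]
      rw [Fintype.sum_prod_type, Fintype.sum_prod_type, Complex.ofReal_sum]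
      refine Finset.sum_congr rfl fun a _ => ?_
      rw [Fintype.sum_prod_type, Complex.ofReal_sum]
      refine Finset.sum_congr rfl fun i _ => ?_
      rw [Complex.ofReal_sum]
      refine Finset.sum_congr rfl fun j _ => ?_
      rw [← sum_sq_coordsOfHerm (isHermitian_blockParts (hherm c) _), ← Complex.ofReal_mul,
        Fintype.sum_prod_type]
      simp only [mul_pow, Finset.mul_sum]
      rfl)
    (uncurry₃ _ _ _ '' {c | (fun i => hermOfCoords (c i)) ∈ S})
  have hS : lebesgue S = volume (uncurry₃ (Fin n × Fin N × Fin N) (Fin m) (Fin m) ''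
      {c | (fun i => hermOfCoords (c i)) ∈ S}) := by
    rw [lebesgue, ← (measurePreserving_uncurry₃ _ _ _).measure_preimage_equiv,
      Set.preimage_image_eq _ (uncurry₃ _ _ _).injective]
  have hS' : lebesgue (blockParts U ⁻¹' S : Set (Fin n → Matrix (Fin k) (Fin k) ℂ))
      = volume (L ⁻¹' (uncurry₃ _ _ _ '' {c | (fun i => hermOfCoords (c i)) ∈ S})) := by
    rw [lebesgue, ← (measurePreserving_uncurry₃ _ _ _).measure_preimage_equiv]
    congr 1
    ext c
    change blockParts U _ ∈ S ↔ uncurry₃ _ _ _ (Φ _) ∈ uncurry₃ _ _ _ '' _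
    rw [(uncurry₃ _ _ _).injective.mem_set_image]
    change _ ↔ (fun i => hermOfCoords (Φ (uncurry₃ _ _ _ c) i)) ∈ S
    have : (fun i => hermOfCoords (Φ (uncurry₃ _ _ _ c) i))
        = blockParts U fun a => hermOfCoords (c a) := by
      funext p
      exact hermOfCoords_coordsOfHerm
        (isHermitian_blockParts (fun a => isHermitian_hermOfCoords _) p)
    rw [this]
  rw [hS', hL, ← hS, prod_blockScale]

end ChangeOfVariables

/-! ### Asymptotic equality in normalized Frobenius norm. -/

section Null

variable {m a b c : ℕ → ℕ}

/-- Convergence to zero in the Frobenius norm, normalized by `√m`. -/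
def IsNull (m : ℕ → ℕ) (A : ∀ t, Matrix (Fin (a t)) (Fin (b t)) ℂ) : Prop :=
  Tendsto (fun t => frob (A t) / √(m t)) atTop (𝓝 0)

/-- Asymptotic equality in the Frobenius norm, normalized by `√m`. -/
def AsympEq (m : ℕ → ℕ) (A B : ∀ t, Matrix (Fin (a t)) (Fin (b t)) ℂ) : Prop :=
  IsNull m fun t => A t - B t

/-- Boundedness in the operator norm. -/
def IsBdd (A : ∀ t, Matrix (Fin (a t)) (Fin (b t)) ℂ) : Prop :=
  ∃ C, ∀ t, ‖A t‖ ≤ C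

theorem IsNull.of_le {A : ∀ t, Matrix (Fin (a t)) (Fin (b t)) ℂ} {f : ℕ → ℝ}
    (hf : Tendsto (fun t => f t / √(m t)) atTop (𝓝 0)) (h : ∀ t, frob (A t) ≤ f t) :
    IsNull m A :=
  squeeze_zero (fun _ => div_nonneg (frob_nonneg _) (Real.sqrt_nonneg _))
    (fun t => div_le_div_of_nonneg_right (h t) (Real.sqrt_nonneg _)) hf

theorem AsympEq.of_eq {A B : ∀ t, Matrix (Fin (a t)) (Fin (b t)) ℂ} (h : ∀ t, A t = B t) :
    AsympEq m A B := by
  simp [AsympEq, IsNull, h, frob_zero]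

theorem AsympEq.symm {A B : ∀ t, Matrix (Fin (a t)) (Fin (b t)) ℂ} (h : AsympEq m A B) :
    AsympEq m B A := by
  simpa only [AsympEq, IsNull, frob_sub_comm (B _)] using h

theorem AsympEq.trans {A B C : ∀ t, Matrix (Fin (a t)) (Fin (b t)) ℂ} (h : AsympEq m A B)
    (h' : AsympEq m B C) : AsympEq m A C := by
  refine IsNull.of_le (f := fun t => frob (A t - B t) + frob (B t - C t)) ?_
    fun t => frob_sub_le _ _ _
  simpa [add_div, AsympEq, IsNull] using Tendsto.add h h'

theorem IsBdd.mul {A : ∀ t, Matrix (Fin (a t)) (Fin (b t)) ℂ}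
    {B : ∀ t, Matrix (Fin (b t)) (Fin (c t)) ℂ} (hA : IsBdd A) (hB : IsBdd B) :
    IsBdd fun t => A t * B t := by
  obtain ⟨C, hC⟩ := hA
  obtain ⟨D, hD⟩ := hB
  exact ⟨C * D, fun t => (l2_opNorm_mul _ _).trans
    (mul_le_mul (hC t) (hD t) (norm_nonneg _) ((norm_nonneg _).trans (hC t)))⟩

theorem IsBdd.conjTranspose {A : ∀ t, Matrix (Fin (a t)) (Fin (b t)) ℂ} (hA : IsBdd A) :
    IsBdd fun t => (A t)ᴴ := by
  obtain ⟨C, hC⟩ := hA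
  exact ⟨C, fun t => (l2_opNorm_conjTranspose _).trans_le (hC t)⟩

theorem AsympEq.conjTranspose {A B : ∀ t, Matrix (Fin (a t)) (Fin (b t)) ℂ}
    (h : AsympEq m A B) : AsympEq m (fun t => (A t)ᴴ) (fun t => (B t)ᴴ) := by
  simpa only [AsympEq, IsNull, ← conjTranspose_sub, frob_conjTranspose] using h

theorem AsympEq.mul_left {A B : ∀ t, Matrix (Fin (b t)) (Fin (c t)) ℂ} (h : AsympEq m A B)
    {D : ∀ t, Matrix (Fin (a t)) (Fin (b t)) ℂ} (hD : IsBdd D) :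
    AsympEq m (fun t => D t * A t) (fun t => D t * B t) := by
  obtain ⟨C, hC⟩ := hD
  refine IsNull.of_le (f := fun t => C * frob (A t - B t)) ?_ fun t => ?_
  · simpa [mul_div_assoc, AsympEq, IsNull] using Tendsto.const_mul C h
  · rw [← Matrix.mul_sub]
    exact (frob_mul_le _ _).trans (mul_le_mul_of_nonneg_right (hC t) (frob_nonneg _))

theorem AsympEq.mul_right {A B : ∀ t, Matrix (Fin (a t)) (Fin (b t)) ℂ} (h : AsympEq m A B)
    {D : ∀ t, Matrix (Fin (b t)) (Fin (c t)) ℂ} (hD : IsBdd D) :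
    AsympEq m (fun t => A t * D t) (fun t => B t * D t) := by
  obtain ⟨C, hC⟩ := hD
  refine IsNull.of_le (f := fun t => frob (A t - B t) * C) ?_ fun t => ?_
  · simpa [mul_div_right_comm, AsympEq, IsNull] using Tendsto.mul_const C h
  · rw [← Matrix.sub_mul]
    exact (frob_mul_le' _ _).trans (mul_le_mul_of_nonneg_left (hC t) (frob_nonneg _))

theorem AsympEq.mul {A B : ∀ t, Matrix (Fin (a t)) (Fin (b t)) ℂ}
    {D E : ∀ t, Matrix (Fin (b t)) (Fin (c t)) ℂ} (h : AsympEq m A B) (h' : AsympEq m D E)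
    (hA : IsBdd A) (hE : IsBdd E) : AsympEq m (fun t => A t * D t) (fun t => B t * E t) :=
  (h'.mul_left hA).trans (h.mul_right hE)

/-- Cauchy–Schwarz against the identity costs `√(a t)`, which is at most `√N √(m t)`. Matrices of
size `N m` may therefore be traced with the normalization of their blocks. -/
theorem AsympEq.tendsto_trace {A B : ∀ t, Matrix (Fin (a t)) (Fin (a t)) ℂ}
    (h : AsympEq m A B) (hm : ∀ t, 0 < m t) {N : ℕ} (ha : ∀ t, a t ≤ N * m t) :
    Tendsto (fun t => (m t : ℂ)⁻¹ * (A t).trace - (m t : ℂ)⁻¹ * (B t).trace) atTop (𝓝 0) := by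
  have h1 : Tendsto (fun t => √N * (frob (A t - B t) / √(m t))) atTop (𝓝 0) := by
    simpa using Tendsto.const_mul (√N) h
  refine squeeze_zero_norm (fun t => ?_) h1
  have hm' : (0 : ℝ) < m t := by exact_mod_cast hm t
  have hs : (0 : ℝ) < √(m t) := Real.sqrt_pos.2 hm'
  rw [← mul_sub, ← trace_sub, norm_mul, norm_inv, Complex.norm_natCast]
  have h2 : √(a t) ≤ √N * √(m t) := by
    rw [← Real.sqrt_mul (by positivity)]
    exact Real.sqrt_le_sqrt (by exact_mod_cast ha t)
  have h3 := norm_trace_le (A t - B t)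
  rw [Fintype.card_fin] at h3
  calc (m t : ℝ)⁻¹ * ‖(A t - B t).trace‖
      ≤ (m t : ℝ)⁻¹ * (√N * √(m t) * frob (A t - B t)) := by
        gcongr
        exact h3.trans (mul_le_mul_of_nonneg_right h2 (frob_nonneg _))
    _ = √N * (frob (A t - B t) / √(m t)) := by
        nth_rewrite 1 [← Real.sq_sqrt hm'.le]
        field_simp

end Null

/-! ### Convergence in moments, and its translation back to microstates. -/

section Moments

variable {A ι : Type*} [Ring A] [Algebra ℂ A]

/-- Convergence in moments of a sequence of tuples of matrices. -/
def MomentsTendsto (τ : A →ₗ[ℂ] ℂ) (X : ι → A) (k : ℕ → ℕ)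
    (x : ∀ t, ι → Matrix (Fin (k t)) (Fin (k t)) ℂ) : Prop :=
  ∀ w : List ι, Tendsto (fun t => (k t : ℂ)⁻¹ * (w.map (x t)).prod.trace) atTop
    (𝓝 (τ (w.map X).prod))

variable {τ : A →ₗ[ℂ] ℂ} {X : ι → A} {k : ℕ → ℕ}
  {x : ∀ t, ι → Matrix (Fin (k t)) (Fin (k t)) ℂ}

theorem MomentsTendsto.tendsto_lift (h : MomentsTendsto τ X k x) (p : FreeAlgebra ℂ ι) :
    Tendsto (fun t => (k t : ℂ)⁻¹ * (FreeAlgebra.lift ℂ (x t) p).trace) atTop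
      (𝓝 (τ (FreeAlgebra.lift ℂ X p))) := by
  let Conv : FreeAlgebra ℂ ι → Prop := fun p =>
    Tendsto (fun t => (k t : ℂ)⁻¹ * (FreeAlgebra.lift ℂ (x t) p).trace) atTop
      (𝓝 (τ (FreeAlgebra.lift ℂ X p)))
  have hadd : ∀ p q, Conv p → Conv q → Conv (p + q) := by
    intro p q hp hq
    simpa [Conv, mul_add] using Tendsto.add hp hq
  have hsmul : ∀ (r : ℂ) p, Conv p → Conv (r • p) := by
    intro r p hp
    simpa [Conv, mul_left_comm] using Tendsto.const_mul r hp
  -- Convergence is not multiplicative, so the induction on `p` carries an arbitrary right factor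
  -- `q` and all words on the left.
  have key : ∀ q, (∀ w : List ι, Conv ((w.map (FreeAlgebra.ι ℂ)).prod * q)) →
      ∀ w : List ι, Conv ((w.map (FreeAlgebra.ι ℂ)).prod * (p * q)) := by
    induction p using FreeAlgebra.induction with
    | grade0 r =>
      intro q hq w
      rw [← Algebra.smul_def, mul_smul_comm]
      exact hsmul _ _ (hq w)
    | grade1 i =>
      intro q hq w
      simpa [mul_assoc] using hq (w ++ [i])
    | mul a b ha hb =>
      intro q hq w
      rw [mul_assoc]
      exact ha _ (hb _ hq) w
    | add a b ha hb =>
      intro q hq w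
      rw [add_mul, mul_add]
      exact hadd _ _ (ha _ hq w) (hb _ hq w)
  have := key 1 (fun w => by simpa [Conv, map_list_prod, Function.comp_def] using h w) []
  simpa [Conv] using this

theorem MomentsTendsto.lift {ι' : Type*} (h : MomentsTendsto τ X k x)
    (f : ι' → FreeAlgebra ℂ ι) :
    MomentsTendsto τ (fun p => FreeAlgebra.lift ℂ X (f p)) k
      (fun t p => FreeAlgebra.lift ℂ (x t) (f p)) := by
  intro w
  simpa [map_list_prod, Function.comp_def] using h.tendsto_lift (w.map f).prod

theorem momentsTendsto_of_mem_microstates {R : ℝ}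
    (h : ∀ t, x t ∈ microstates τ X R (k t) t (1 / ((t : ℝ) + 1))) : MomentsTendsto τ X k x := by
  intro w
  rw [← tendsto_sub_nhds_zero_iff]
  refine squeeze_zero_norm' ?_ tendsto_one_div_add_atTop_nhds_zero_nat
  filter_upwards [eventually_ge_atTop w.length] with t ht
  exact ((h t).2.2 w ht).le

/-- A property of matrix tuples which holds along all sequences converging in moments holds for
all good enough microstates. -/
theorem exists_forall_mem_microstates (τ : A →ₗ[ℂ] ℂ) (X : ι → A) (R : ℝ) (κ : ℕ → ℕ)
    (P : ∀ m, (ι → Matrix (Fin (κ m)) (Fin (κ m)) ℂ) → Prop)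
    (h : ∀ (m : ℕ → ℕ) (x : ∀ t, ι → Matrix (Fin (κ (m t))) (Fin (κ (m t))) ℂ),
      (∀ t, 0 < m t) → (∀ t i, (x t i).IsHermitian) → (∀ t i, ‖x t i‖ ≤ R) →
      MomentsTendsto τ X (fun t => κ (m t)) x → ∃ t, P (m t) (x t)) :
    ∃ (l : ℕ) (ε : ℝ), 0 < ε ∧ ∀ m, 0 < m → ∀ x ∈ microstates τ X R (κ m) l ε, P m x := by
  -- Counterexamples for `l = t` and `ε = 1 / (t + 1)` form a sequence converging in moments. Their
  -- sizes need not grow, so the resulting `l` and `ε` serve every positive `m`.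
  by_contra! hcon
  choose m hm x hx hP using fun t : ℕ => hcon t (1 / ((t : ℝ) + 1)) (by positivity)
  obtain ⟨t, ht⟩ := h m x hm (fun t => (hx t).1) (fun t => (hx t).2.1)
    (momentsTendsto_of_mem_microstates hx)
  exact hP t ht

theorem microstates_mono {R : ℝ} {k l l' : ℕ} {ε ε' : ℝ} (hl : l ≤ l') (hε : ε' ≤ ε) :
    microstates τ X R k l' ε' ⊆ microstates τ X R k l ε :=
  fun _ hx => ⟨hx.1, hx.2.1, fun w hw => (hx.2.2 w (hw.trans hl)).trans_le hε⟩

/-- If finitely many functions of matrix tuples converge in moments along all sequences of tuples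
which converge in moments, then they map good microstates to microstates. -/
theorem exists_forall_mem_microstates_map {A' ι' : Type*} [Ring A'] [Algebra ℂ A'] [Finite ι']
    (τ : A →ₗ[ℂ] ℂ) (X : ι → A) (R : ℝ) (κ κ' : ℕ → ℕ)
    (τ' : A' →ₗ[ℂ] ℂ) (X' : ι' → A') (R' : ℝ) (l : ℕ) {ε : ℝ} (hε : 0 < ε)
    (F : ∀ m, (ι → Matrix (Fin (κ m)) (Fin (κ m)) ℂ) →
      Set (ι' → Matrix (Fin (κ' m)) (Fin (κ' m)) ℂ))
    (hF : ∀ m, 0 < m → ∀ x, (∀ i, (x i).IsHermitian) → (∀ i, ‖x i‖ ≤ R) →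
      ∀ x' ∈ F m x, (∀ i, (x' i).IsHermitian) ∧ ∀ i, ‖x' i‖ ≤ R')
    (h : ∀ (m : ℕ → ℕ) (x : ∀ t, ι → Matrix (Fin (κ (m t))) (Fin (κ (m t))) ℂ)
      (x' : ∀ t, ι' → Matrix (Fin (κ' (m t))) (Fin (κ' (m t))) ℂ),
      (∀ t, 0 < m t) → (∀ t i, (x t i).IsHermitian) → (∀ t i, ‖x t i‖ ≤ R) →
      (∀ t, x' t ∈ F (m t) (x t)) →
      MomentsTendsto τ X (fun t => κ (m t)) x → MomentsTendsto τ' X' (fun t => κ' (m t)) x') :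
    ∃ (l' : ℕ) (ε' : ℝ), 0 < ε' ∧ ∀ m, 0 < m → ∀ x ∈ microstates τ X R (κ m) l' ε',
      ∀ x' ∈ F m x, x' ∈ microstates τ' X' R' (κ' m) l ε := by
  -- Each word gets its own pair of thresholds. Only finitely many words have length at most `l`, so
  -- a common upper bound of the lengths and the minimum of the tolerances serve all of them.
  have hw : ∀ w : List ι', ∃ (l' : ℕ) (ε' : ℝ), 0 < ε' ∧ ∀ m, 0 < m →
      ∀ x ∈ microstates τ X R (κ m) l' ε', ∀ x' ∈ F m x,
        ‖(κ' m : ℂ)⁻¹ * (w.map x').prod.trace - τ' (w.map X').prod‖ < ε := by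
    intro w
    refine exists_forall_mem_microstates τ X R κ (fun m x => ∀ x' ∈ F m x,
      ‖(κ' m : ℂ)⁻¹ * (w.map x').prod.trace - τ' (w.map X').prod‖ < ε) ?_
    intro m x hm hx hR hmom
    by_contra! hcon
    choose x' hx' hle using hcon
    have := tendsto_sub_nhds_zero_iff.2 (h m x x' hm hx hR hx' hmom w)
    have := (tendsto_zero_iff_norm_tendsto_zero.1 this).eventually (gt_mem_nhds hε)
    obtain ⟨t, ht⟩ := this.exists
    exact (hle t).not_gt ht
  choose L E hE hLE using hw
  have hfin : {w : List ι' | w.length ≤ l}.Finite := List.finite_length_le ι' l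
  obtain ⟨l', hl'⟩ := (hfin.image L).bddAbove
  have hε' : ∃ ε' > 0, ∀ w ∈ {w : List ι' | w.length ≤ l}, ε' ≤ E w := by
    have hne : (hfin.toFinset.image E).Nonempty :=
      ⟨E [], Finset.mem_image_of_mem _ (by simp)⟩
    refine ⟨(hfin.toFinset.image E).min' hne, ?_, fun w hw => ?_⟩
    · obtain ⟨w, -, hw⟩ := Finset.mem_image.1 ((hfin.toFinset.image E).min'_mem hne)
      rw [gt_iff_lt, ← hw]
      exact hE w
    · exact Finset.min'_le _ _ (Finset.mem_image_of_mem _ (hfin.mem_toFinset.2 hw))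
  obtain ⟨ε', hpos, hε'⟩ := hε'
  refine ⟨l', ε', hpos, fun m hm x hx x' hx' => ?_⟩
  obtain ⟨h1, h2⟩ := hF m hm x hx.1 hx.2.1 x' hx'
  exact ⟨h1, h2, fun w hw => hLE w m hm x
    (microstates_mono (hl' (Set.mem_image_of_mem L hw)) (hε' w hw) hx) x' hx'⟩

end Moments

/-! ### Exact frames from approximate matrix units. -/

section AdaptedFrame

variable {N m : ℕ}

/-- A frame adapted to a matrix `h`, close to a projection of rank `m`, and to matrices `s i`
which map its range to orthogonal subspaces. -/
def IsAdapted (h : Matrix (Fin (N * m)) (Fin (N * m)) ℂ)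
    (s : Fin N → Matrix (Fin (N * m)) (Fin (N * m)) ℂ)
    (U : Fin N → Matrix (Fin (N * m)) (Fin m) ℂ) : Prop :=
  IsFrame U ∧ (h.IsHermitian → 0 < N → ∃ V : Matrix (Fin (N * m)) (Fin m) ℂ, Vᴴ * V = 1 ∧
    frob (V * Vᴴ - h) ≤ √(‖(m : ℂ) - h.trace‖ + √(N * m : ℕ) * (2 * frob (h * h - h)))
      + 2 * frob (h * h - h) ∧
    ∀ i, frob (U i - s i * V)
      ≤ ∑ p, ∑ q, frob ((s p * V)ᴴ * (s q * V) - if p = q then 1 else 0))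

/-- An isometry `V` onto a projection near `h` is moved by the `s i`, and the matrices `s i * V` are
placed side by side into a square matrix `A`. The blocks of `Aᴴ * A - 1` measure the failure of
orthonormality, and a unitary near `A` supplies the frame. -/
theorem exists_isAdapted (h : Matrix (Fin (N * m)) (Fin (N * m)) ℂ)
    (s : Fin N → Matrix (Fin (N * m)) (Fin (N * m)) ℂ) : ∃ U, IsAdapted h s U := by
  by_cases hh : h.IsHermitian ∧ 0 < N
  -- In the degenerate case the estimates are void and any frame will do.
  swap
  · obtain ⟨U, hU⟩ := exists_isFrame N m
    exact ⟨U, hU, fun h1 h2 => absurd ⟨h1, h2⟩ hh⟩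
  obtain ⟨V, hV, hVh⟩ := exists_isometry_frob_sub_le hh.1 (m := m)
    (by simpa using Nat.le_mul_of_pos_left m hh.2)
  let A : Matrix (Fin (N * m)) (Fin N × Fin m) ℂ := Matrix.of fun r q => (s q.1 * V) r q.2
  obtain ⟨W, hW, hW', hWA⟩ := exists_unitary_frob_sub_le (by simp) A
  refine ⟨_, isFrame_of_unitary hW hW', fun _ _ => ⟨V, hV, by simpa using hVh, fun i => ?_⟩⟩
  have h0 : 0 ≤ ∑ p, ∑ q, frob ((s p * V)ᴴ * (s q * V) - if p = q then 1 else 0) :=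
    Finset.sum_nonneg fun _ _ => Finset.sum_nonneg fun _ _ => frob_nonneg _
  rw [← sq_le_sq₀ (frob_nonneg _) h0]
  calc _ ≤ frob (W - A) ^ 2 := by
        rw [frob_sq, frob_sq]
        refine Finset.sum_le_sum fun r _ => ?_
        rw [Fintype.sum_prod_type]
        exact Finset.single_le_sum (f := fun p => ∑ b, ‖(W - A) r (p, b)‖ ^ 2)
          (fun p _ => Finset.sum_nonneg fun b _ => by positivity) (Finset.mem_univ i)
    _ ≤ frob (Aᴴ * A - 1) ^ 2 := pow_le_pow_left₀ (frob_nonneg _) hWA 2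
    _ = ∑ p, ∑ q, frob ((s p * V)ᴴ * (s q * V) - if p = q then 1 else 0) ^ 2 := by
        have e : ∀ p q, frob ((s p * V)ᴴ * (s q * V) - if p = q then 1 else 0) ^ 2
            = ∑ a, ∑ b,
              ‖(Aᴴ * A - 1 : Matrix (Fin N × Fin m) (Fin N × Fin m) ℂ) (p, a) (q, b)‖ ^ 2 := by
          intro p q
          rw [frob_sq]
          refine Finset.sum_congr rfl fun a _ => Finset.sum_congr rfl fun b _ => ?_
          congr 2
          by_cases hpq : p = q <;> simp [Matrix.mul_apply, A, hpq, one_apply, mul_comm]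
        simp only [e]
        rw [frob_sq, Fintype.sum_prod_type]
        simp only [Fintype.sum_prod_type]
        refine Finset.sum_congr rfl fun p _ => ?_
        rw [Finset.sum_comm]
    _ ≤ _ := by
        refine (Finset.sum_le_sum fun p _ =>
          Finset.sum_sq_le_sq_sum_of_nonneg fun q _ => frob_nonneg _).trans ?_
        exact Finset.sum_sq_le_sq_sum_of_nonneg fun p _ =>
          Finset.sum_nonneg fun q _ => frob_nonneg _

end AdaptedFrame

/-! ### Moments of blocks along adapted frames. -/

section Corner

variable {m : ℕ → ℕ} {d : ℕ → ℕ} {h : ∀ t, Matrix (Fin (d t)) (Fin (d t)) ℂ}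
  {V : ∀ t, Matrix (Fin (d t)) (Fin (m t)) ℂ}

theorem isBdd_of_isometry (hV : ∀ t, (V t)ᴴ * V t = 1) : IsBdd V :=
  ⟨1, fun t => norm_le_one_of_isometry (hV t)⟩

/-- Cutting down by an almost projection does not matter in the corner. -/
theorem AsympEq.corner (hV : ∀ t, (V t)ᴴ * V t = 1)
    (hP : AsympEq m (fun t => V t * (V t)ᴴ) h) (hh : IsBdd h)
    {Q : ∀ t, Matrix (Fin (d t)) (Fin (d t)) ℂ} (hQ : IsBdd Q) :
    AsympEq m (fun t => (V t)ᴴ * Q t * V t) (fun t => (V t)ᴴ * (h t * Q t * h t) * V t) := by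
  have bV := isBdd_of_isometry hV
  -- Since `Vᴴ * V = 1`, the projection `V * Vᴴ` can be inserted on both sides of `Q` at no cost and
  -- then replaced by `h`.
  have e1 : ∀ t, (V t)ᴴ * Q t * V t
      = (V t)ᴴ * (V t * (V t)ᴴ * Q t * (V t * (V t)ᴴ)) * V t := by
    intro t
    have e2 : (V t)ᴴ * (V t * (V t)ᴴ * Q t * (V t * (V t)ᴴ)) * V t
        = ((V t)ᴴ * V t) * (V t)ᴴ * Q t * V t * ((V t)ᴴ * V t) := by
      simp only [Matrix.mul_assoc]
    rw [e2, hV, Matrix.one_mul, Matrix.mul_one]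
  refine (AsympEq.of_eq e1).trans ?_
  refine AsympEq.mul_right (AsympEq.mul_left ?_ bV.conjTranspose) bV
  exact AsympEq.mul (hP.mul_right hQ) hP ((bV.mul bV.conjTranspose).mul hQ) hh

end Corner

section CompressMoments

variable {M ι : Type*} [Ring M] [Algebra ℂ M] {N : ℕ} {τ : M →ₗ[ℂ] ℂ}
  {X : ι → Matrix (Fin N) (Fin N) M}

theorem matTrace_apply (a : Matrix (Fin N) (Fin N) M) :
    matTrace N τ a = (N : ℂ)⁻¹ * τ a.trace := rfl

/-- The squared normalized norm is a multiple of the moment of `p' * p`, whose limit is the trace of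
`0`. The polynomial `p'` plays the adjoint of `p` on the matrices, so no involution on the free
algebra is needed. -/
theorem MomentsTendsto.isNull {A : Type*} [Ring A] [Algebra ℂ A] {τ : A →ₗ[ℂ] ℂ} {X : ι → A}
    {m : ℕ → ℕ} {x : ∀ t, ι → Matrix (Fin (N * m t)) (Fin (N * m t)) ℂ}
    (hmom : MomentsTendsto τ X (fun t => N * m t) x) (hN : 0 < N) {p p' : FreeAlgebra ℂ ι}
    (hp : ∀ t, (FreeAlgebra.lift ℂ (x t) p)ᴴ = FreeAlgebra.lift ℂ (x t) p')
    (h0 : FreeAlgebra.lift ℂ X p = 0) : IsNull m fun t => FreeAlgebra.lift ℂ (x t) p := by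
  have h1 := hmom.tendsto_lift (p' * p)
  rw [map_mul, h0, mul_zero, map_zero] at h1
  have h2 : Tendsto (fun t => (frob (FreeAlgebra.lift ℂ (x t) p) / √(m t)) ^ 2) atTop (𝓝 0) := by
    have h3 := (h1.norm).const_mul (N : ℝ)
    rw [norm_zero, mul_zero] at h3
    refine h3.congr fun t => ?_
    rw [map_mul, ← hp, ← frob_sq_eq_trace, norm_mul, norm_inv, Complex.norm_natCast,
      Complex.norm_real, Real.norm_of_nonneg (sq_nonneg _), div_pow, Real.sq_sqrt (by positivity)]
    have : (N : ℝ) ≠ 0 := by positivity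
    push_cast
    field_simp
  have h3 := (Real.continuous_sqrt.tendsto 0).comp h2
  rw [Real.sqrt_zero] at h3
  refine h3.congr fun t => ?_
  exact Real.sqrt_sq (div_nonneg (frob_nonneg _) (Real.sqrt_nonneg _))

omit [Algebra ℂ M] in
theorem prod_single_mul_single (o : Fin N) (l : List M) :
    (l.map (single o o)).prod * single o o 1 = single o o l.prod := by
  induction l with
  | nil => simp
  | cons a l ih => rw [List.map_cons, List.prod_cons, mul_assoc, ih, single_mul_single_same,
      List.prod_cons]

/-- The blocks of a sequence of tuples which converges in moments, along frames adapted to the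
images of matrix units, converge in moments to the matrix entries of the limit. -/
theorem MomentsTendsto.blocks {m : ℕ → ℕ}
    {x : ∀ t, ι → Matrix (Fin (N * m t)) (Fin (N * m t)) ℂ}
    (hmom : MomentsTendsto (matTrace N τ) X (fun t => N * m t) x) (hτ : τ 1 = 1)
    (hm : ∀ t, 0 < m t) (hx : ∀ t i, (x t i).IsHermitian) {R : ℝ} (hR : ∀ t i, ‖x t i‖ ≤ R)
    (e : ι) (s : Fin N → ι) (o : Fin N) (hE : X e = single o o 1)
    (hS : ∀ i, X (s i) * single o o 1 = single i o 1)
    (hS' : ∀ i, single o o 1 * X (s i) = single o i 1)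
    {U : ∀ t, Fin N → Matrix (Fin (N * m t)) (Fin (m t)) ℂ}
    (hU : ∀ t, IsAdapted (x t e) (fun i => x t (s i)) (U t)) :
    MomentsTendsto τ (fun q : ι × Fin N × Fin N => X q.1 q.2.1 q.2.2) m
      (fun t q => compress (U t) (x t q.1) q.2.1 q.2.2) := by
  have hN : 0 < N := o.pos
  have hNC : (N : ℂ) ≠ 0 := by exact_mod_cast hN.ne'
  choose hfr hV using fun t => hU t
  choose V hV hVh hUV using fun t => hV t (hx t e) hN
  have bx : ∀ i, IsBdd fun t => x t i := fun i => ⟨R, fun t => hR t i⟩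
  have bV : IsBdd V := isBdd_of_isometry hV
  have bU : ∀ i, IsBdd fun t => U t i := fun i => ⟨1, fun t => (hfr t).norm_le_one i⟩
  -- the almost idempotent
  have n1 : IsNull m fun t => x t e * x t e - x t e := by
    have := hmom.isNull hN (p := FreeAlgebra.ι ℂ e * FreeAlgebra.ι ℂ e - FreeAlgebra.ι ℂ e)
      (p' := FreeAlgebra.ι ℂ e * FreeAlgebra.ι ℂ e - FreeAlgebra.ι ℂ e)
      (fun t => by simp [(hx t e).eq]) (by simp [hE])
    simpa using this
  -- The matrix unit has normalized trace `1 / N`, so its model of size `N m` has trace close to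
  -- `m`, the rank required of the projection.
  have n2 : Tendsto (fun t => ‖(m t : ℂ) - (x t e).trace‖ / m t) atTop (𝓝 0) := by
    have h1 := hmom [e]
    simp only [List.map_cons, List.map_nil, List.prod_cons, List.prod_nil, mul_one, hE,
      matTrace_apply, trace_single_eq_same, hτ] at h1
    have h2 := (tendsto_const_nhds (x := (1 : ℂ))).sub (h1.const_mul (N : ℂ))
    rw [mul_inv_cancel₀ hNC, sub_self] at h2
    have h3 := h2.norm
    rw [norm_zero] at h3
    refine h3.congr fun t => ?_
    have hmt : (m t : ℂ) ≠ 0 := by exact_mod_cast (hm t).ne'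
    rw [← Complex.norm_natCast, ← norm_div]
    congr 1
    push_cast
    field_simp
  have hP : AsympEq m (fun t => V t * (V t)ᴴ) (fun t => x t e) := by
    refine IsNull.of_le ?_ hVh
    have h1 : Tendsto (fun t => √(‖(m t : ℂ) - (x t e).trace‖ / m t
        + √N * (2 * (frob (x t e * x t e - x t e) / √(m t))))
        + 2 * (frob (x t e * x t e - x t e) / √(m t))) atTop
        (𝓝 (√(0 + √N * (2 * 0)) + 2 * 0)) :=
      (((n2.add ((n1.const_mul 2).const_mul (√N))).sqrt)).add (n1.const_mul 2)
    simp only [mul_zero, add_zero, Real.sqrt_zero] at h1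
    refine h1.congr fun t => ?_
    have hm' : (0 : ℝ) < m t := by exact_mod_cast hm t
    have hs : (0 : ℝ) < √(m t) := Real.sqrt_pos.2 hm'
    rw [add_div, mul_div_assoc, ← Real.sqrt_div' _ hm'.le, add_div]
    congr 3
    push_cast
    rw [Real.sqrt_mul (by positivity)]
    nth_rewrite 3 [← Real.sq_sqrt hm'.le]
    field_simp
  have hhh : AsympEq m (fun t => x t e * x t e) (fun t => x t e) := n1
  -- the almost matrix units
  have hss : ∀ i j, AsympEq m (fun t => x t e * (x t (s i) * x t (s j)) * x t e)
      (fun t => if i = j then x t e else 0) := by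
    intro i j
    have := hmom.isNull hN
      (p := FreeAlgebra.ι ℂ e * (FreeAlgebra.ι ℂ (s i) * FreeAlgebra.ι ℂ (s j)) * FreeAlgebra.ι ℂ e
        - if i = j then FreeAlgebra.ι ℂ e else 0)
      (p' := FreeAlgebra.ι ℂ e * (FreeAlgebra.ι ℂ (s j) * FreeAlgebra.ι ℂ (s i))
        * FreeAlgebra.ι ℂ e - if i = j then FreeAlgebra.ι ℂ e else 0)
      (fun t => by split_ifs <;> simp [(hx t _).eq, Matrix.mul_assoc]) (by
        have : single o o (1 : M) * (X (s i) * X (s j)) * single o o 1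
            = single o i 1 * single j o 1 := by
          rw [← hS j, ← hS' i]
          simp only [mul_assoc]
        split_ifs with hij
        · subst hij
          simp [hE, this]
        · simp [hE, this, single_mul_single_of_ne _ _ _ _ hij])
    refine Eq.mp ?_ this
    unfold AsympEq
    congr 1
    funext t
    split_ifs <;> simp
  have hUs : ∀ i, AsympEq m (fun t => U t i) (fun t => x t (s i) * V t) := by
    intro i
    refine IsNull.of_le ?_ (fun t => hUV t i)
    have h1 : ∀ p q, Tendsto (fun t => frob ((x t (s p) * V t)ᴴ * (x t (s q) * V t)
        - if p = q then 1 else 0) / √(m t)) atTop (𝓝 0) := by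
      intro p q
      have e1 : ∀ t, (x t (s p) * V t)ᴴ * (x t (s q) * V t)
          = (V t)ᴴ * (x t (s p) * x t (s q)) * V t := fun t => by
        rw [conjTranspose_mul, (hx t _).eq]
        simp only [Matrix.mul_assoc]
      refine (AsympEq.of_eq e1).trans ((AsympEq.corner hV hP (bx e)
        ((bx (s p)).mul (bx (s q)))).trans ?_)
      refine (((hss p q).mul_left bV.conjTranspose).mul_right bV).trans ?_
      by_cases hpq : p = q
      · simp only [hpq, if_true]
        refine ((hP.symm.mul_left bV.conjTranspose).mul_right bV).trans (AsympEq.of_eq fun t => ?_)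
        rw [← Matrix.mul_assoc, hV, Matrix.one_mul, hV]
      · simp only [hpq, if_false]
        exact AsympEq.of_eq fun t => by simp
    simp only [Finset.sum_div]
    simpa using tendsto_finsetSum Finset.univ fun p _ =>
      tendsto_finsetSum Finset.univ fun q _ => h1 p q
  -- blocks and words in the blocks
  let Q : ∀ t, ι × Fin N × Fin N → Matrix (Fin (N * m t)) (Fin (N * m t)) ℂ := fun t q =>
    x t e * (x t (s q.2.1) * x t q.1 * x t (s q.2.2)) * x t e
  have bQ : ∀ q, IsBdd fun t => Q t q := fun q =>
    ((bx _).mul (((bx _).mul (bx _)).mul (bx _))).mul (bx _)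
  have bQw : ∀ w : List (ι × Fin N × Fin N), IsBdd fun t => (w.map (Q t)).prod := by
    intro w
    induction w with
    | nil => exact ⟨1, fun t => norm_le_one_of_isometry (by simp)⟩
    | cons q w ih => simpa using (bQ q).mul ih
  have hQe : ∀ q, AsympEq m (fun t => Q t q * x t e) (fun t => Q t q) := by
    intro q
    refine (AsympEq.of_eq fun t => ?_).trans
      (hhh.mul_left ((bx e).mul (((bx _).mul (bx q.1)).mul (bx _))))
    exact Matrix.mul_assoc _ _ _
  have hblock : ∀ q : ι × Fin N × Fin N, AsympEq m
      (fun t => compress (U t) (x t q.1) q.2.1 q.2.2) (fun t => (V t)ᴴ * Q t q * V t) := by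
    intro q
    have h1 : AsympEq m (fun t => compress (U t) (x t q.1) q.2.1 q.2.2)
        (fun t => (x t (s q.2.1) * V t)ᴴ * x t q.1 * (x t (s q.2.2) * V t)) :=
      AsympEq.mul ((hUs _).conjTranspose.mul_right (bx _)) (hUs _)
        ((bU _).conjTranspose.mul (bx _)) ((bx _).mul bV)
    refine h1.trans ((AsympEq.of_eq fun t => ?_).trans (AsympEq.corner hV hP (bx e)
      (((bx (s q.2.1)).mul (bx q.1)).mul (bx (s q.2.2)))))
    rw [conjTranspose_mul, (hx t _).eq]
    simp only [Matrix.mul_assoc]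
  have hword : ∀ w : List (ι × Fin N × Fin N), AsympEq m
      (fun t => (w.map fun q => compress (U t) (x t q.1) q.2.1 q.2.2).prod)
      (fun t => (V t)ᴴ * (w.map (Q t)).prod * V t) := by
    intro w
    induction w with
    | nil => exact AsympEq.of_eq fun t => by simp [hV]
    | cons q w ih =>
      simp only [List.map_cons, List.prod_cons]
      have bc : IsBdd fun t => compress (U t) (x t q.1) q.2.1 q.2.2 :=
        ((bU _).conjTranspose.mul (bx _)).mul (bU _)
      refine (AsympEq.mul (hblock q) ih bc ((bV.conjTranspose.mul (bQw w)).mul bV)).trans ?_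
      -- The factor `V * Vᴴ` between consecutive blocks is close to `x e`, which `Q` absorbs because
      -- it ends in the almost idempotent `x e`.
      have h2 : AsympEq m (fun t => Q t q * (V t * (V t)ᴴ)) (fun t => Q t q) :=
        (hP.mul_left (bQ q)).trans (hQe q)
      refine (AsympEq.of_eq fun t => ?_).trans
        (((h2.mul_right (bQw w)).mul_left bV.conjTranspose).mul_right bV)
      simp only [Matrix.mul_assoc]
  -- the moments
  intro w
  have ht1 := (hword w).tendsto_trace hm (N := 1) (fun t => by simp)
  have ht2 : Tendsto (fun t => (m t : ℂ)⁻¹ * ((V t)ᴴ * (w.map (Q t)).prod * V t).trace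
      - (m t : ℂ)⁻¹ * ((w.map (Q t)).prod * x t e).trace) atTop (𝓝 0) := by
    refine ((hP.mul_left (bQw w)).tendsto_trace hm (N := N) (fun t => le_rfl)).congr fun t => ?_
    rw [Matrix.mul_assoc, Matrix.trace_mul_comm (V t)ᴴ, Matrix.mul_assoc]
  let pQ : ι × Fin N × Fin N → FreeAlgebra ℂ ι := fun q => FreeAlgebra.ι ℂ e *
    (FreeAlgebra.ι ℂ (s q.2.1) * FreeAlgebra.ι ℂ q.1 * FreeAlgebra.ι ℂ (s q.2.2)) *
    FreeAlgebra.ι ℂ e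
  -- The factor `N` converts the normalization by `N m` into the one by `m`.
  have ht3 := (hmom.tendsto_lift ((w.map pQ).prod * FreeAlgebra.ι ℂ e)).const_mul (N : ℂ)
  have hlim : (N : ℂ) * matTrace N τ (FreeAlgebra.lift ℂ X ((w.map pQ).prod * FreeAlgebra.ι ℂ e))
      = τ (w.map fun q => X q.1 q.2.1 q.2.2).prod := by
    have h1 : ∀ q, FreeAlgebra.lift ℂ X (pQ q) = single o o (X q.1 q.2.1 q.2.2) := by
      intro q
      have : single o o (1 : M) * (X (s q.2.1) * X q.1 * X (s q.2.2)) * single o o 1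
          = single o q.2.1 1 * X q.1 * single q.2.2 o 1 := by
        rw [← hS q.2.2, ← hS' q.2.1]
        simp only [mul_assoc]
      simp only [pQ, map_mul, FreeAlgebra.lift_ι_apply, hE, this]
      rw [single_mul_mul_single, one_mul, mul_one]
    have h2 := prod_single_mul_single o (w.map fun q => X q.1 q.2.1 q.2.2)
    rw [List.map_map] at h2
    rw [map_mul, map_list_prod, List.map_map, FreeAlgebra.lift_ι_apply, hE,
      show ⇑(FreeAlgebra.lift ℂ X) ∘ pQ = single o o ∘ fun q => X q.1 q.2.1 q.2.2 from funext h1,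
      h2,
      matTrace_apply, trace_single_eq_same, mul_inv_cancel_left₀ hNC]
  rw [hlim] at ht3
  have h4 := (ht1.add ht2).add ht3
  rw [add_zero, zero_add] at h4
  refine h4.congr fun t => ?_
  have hq : FreeAlgebra.lift ℂ (x t) ((w.map pQ).prod * FreeAlgebra.ι ℂ e)
      = (w.map (Q t)).prod * x t e := by
    rw [map_mul, map_list_prod, List.map_map, FreeAlgebra.lift_ι_apply]
    congr 3
    funext q
    simp [pQ, Q]
  rw [hq]
  have hmt : (m t : ℂ) ≠ 0 := by exact_mod_cast (hm t).ne'
  push_cast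
  field_simp
  ring

end CompressMoments

/-! ### Reindexing and monotonicity of the entropies. -/

section Reindex

variable {A ι κ κ' : Type*} [Ring A] [Algebra ℂ A] {τ : A →ₗ[ℂ] ℂ}

theorem comp_mem_microstates {X : ι → A} {R : ℝ} {k l : ℕ} {ε : ℝ}
    {x : ι → Matrix (Fin k) (Fin k) ℂ} (hx : x ∈ microstates τ X R k l ε) (f : κ → ι) :
    x ∘ f ∈ microstates τ (X ∘ f) R k l ε :=
  ⟨fun i => hx.1 (f i), fun i => hx.2.1 (f i), fun w hw => by
    simpa using hx.2.2 (w.map f) (by simpa using hw)⟩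

theorem relMicrostates_comp_subset {X : ι → A} {Y : κ → A} {R : ℝ} {k l : ℕ} {ε : ℝ}
    {y : κ → Matrix (Fin k) (Fin k) ℂ} (f : κ' → κ) :
    relMicrostates τ X Y R k l ε y ⊆ relMicrostates τ X (Y ∘ f) R k l ε (y ∘ f) := by
  intro x hx
  have := comp_mem_microstates hx (Sum.map id f)
  rwa [Sum.elim_comp_map, Sum.elim_comp_map, Function.comp_id, Function.comp_id] at this

variable [Fintype ι]

theorem lebesgue_mono {k : ℕ} {S T : Set (ι → Matrix (Fin k) (Fin k) ℂ)} (h : S ⊆ T) :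
    lebesgue S ≤ lebesgue T :=
  MeasureTheory.measure_mono fun _ hc => h hc

theorem log_lebesgue_of_eq_empty {k : ℕ} {S : Set (ι → Matrix (Fin k) (Fin k) ℂ)} (h : S = ∅) :
    ENNReal.log (lebesgue S) = ⊥ := by
  simp [h, lebesgue]

theorem chiRel_comp_equiv_le (F : Filter ℕ) (X : ι → A) (Y : κ → A) (e : κ' ≃ κ) :
    chiRel F τ X (Y ∘ e) ≤ chiRel F τ X Y := by
  refine iSup₂_mono fun R _ => iInf_mono fun l => iInf₂_mono fun ε _ => ?_
  refine limsup_le_limsup (Eventually.of_forall fun k => ?_)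
  refine add_le_add_left (mul_le_mul_of_nonneg_left ?_ (EReal.coe_nonneg.2 (by positivity))) _
  refine iSup₂_le fun y hy => ?_
  have h1 : Y = (Y ∘ e) ∘ e.symm := by funext i; simp
  have h2 := comp_mem_microstates hy e.symm
  rw [← h1] at h2
  refine le_trans (ENNReal.log_monotone (lebesgue_mono ?_)) (le_iSup₂
    (f := fun y (_ : y ∈ microstates τ Y R k l ε) =>
      ENNReal.log (lebesgue (relMicrostates τ X Y R k l ε y))) (y ∘ e.symm) h2)
  have h3 := relMicrostates_comp_subset (τ := τ) (X := X) (Y := Y ∘ e) (R := R) (l := l) (ε := ε)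
    (y := y) e.symm
  rwa [← h1] at h3

/-- Conditioning tuples in `chi` are indexed by `Fin m`; this allows any finite index type. -/
theorem chi_le_chiRel [StarRing A] [Finite κ] (F : Filter ℕ) (X : ι → A) {B : Subalgebra ℂ A}
    {Y : κ → A} (hY : ∀ j, Y j ∈ B ∧ IsSelfAdjoint (Y j)) : chi F τ X B ≤ chiRel F τ X Y := by
  obtain ⟨p, ⟨e⟩⟩ := Finite.exists_equiv_fin κ
  refine le_trans ?_ (chiRel_comp_equiv_le F X Y e.symm)
  exact iInf_le_of_le p (iInf_le_of_le _ (iInf_le_of_le (fun j => hY _) le_rfl))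

end Reindex

/-! ### Normalizing constants as an order automorphism of `EReal`. -/

section Arithmetic

/-- The order automorphism `x ↦ a x - b` of the extended reals. -/
def affineOrderIso (a : ℝ) (ha : 0 < a) (b : ℝ) : EReal ≃o EReal where
  toFun x := (a : EReal) * x - (b : EReal)
  invFun y := ((a⁻¹ : ℝ) : EReal) * (y + (b : EReal))
  left_inv x := by
    induction x with
    | bot => simp [EReal.coe_mul_bot_of_pos, ha]
    | top => simp [EReal.coe_mul_top_of_pos, ha]
    | coe x =>
      simp only [← EReal.coe_mul, ← EReal.coe_sub, ← EReal.coe_add]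
      congr 1
      field_simp
      ring
  right_inv x := by
    induction x with
    | bot => simp [EReal.coe_mul_bot_of_pos, ha]
    | top => simp [EReal.coe_mul_top_of_pos, ha]
    | coe x =>
      simp only [← EReal.coe_mul, ← EReal.coe_sub, ← EReal.coe_add]
      congr 1
      field_simp
      ring
  map_rel_iff' {x y} := by
    change (a : EReal) * x - b ≤ (a : EReal) * y - b ↔ x ≤ y
    induction x <;> induction y <;>
      simp [EReal.coe_mul_bot_of_pos, EReal.coe_mul_top_of_pos, ha, ← EReal.coe_mul,
        ← EReal.coe_sub]

/-- The constant in the transformation formula for the free entropy. -/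
def entropyShift (n N : ℕ) : ℝ :=
  (N : ℝ) ^ 2 * ((n : ℝ) / 2) * Real.log N + (n : ℝ) * (N : ℝ) * ((N : ℝ) - 1) / 2 * Real.log 2

/-- The transformation of the free entropies of matrices into those of their entries. -/
def entropyIso (n N : ℕ) (hN : 0 < N) : EReal ≃o EReal :=
  affineOrderIso ((N : ℝ) ^ 2) (by positivity) (entropyShift n N)

theorem log_ofReal_jacobian (n N m : ℕ) (hN : 0 < N) :
    ENNReal.log (ENNReal.ofReal (√2 ^ (n * (N * (N - 1)) * m ^ 2)))
      = (((m : ℝ) ^ 2 * ((n : ℝ) * (N : ℝ) * ((N : ℝ) - 1) / 2 * Real.log 2) : ℝ) : EReal) := by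
  rw [ENNReal.log_ofReal_of_pos (by positivity), Real.log_pow, Real.log_sqrt (by norm_num)]
  congr 1
  push_cast [Nat.cast_sub (Nat.succ_le_of_lt hN)]
  ring

/-- The weight `N ^ 2 / (N m) ^ 2` is `1 / m ^ 2`, the Jacobian contributes exactly the `log 2` part
of `entropyShift`, and splitting `log (N m)` cancels the `log N` part. Being an order isomorphism,
the map then passes through every infimum, supremum and limsup, infinite values included. -/
theorem entropyIso_normalized (n N m : ℕ) (hN : 0 < N) (hm : 0 < m) (s : EReal) :
    entropyIso n N hN (((((N * m : ℕ) : ℝ) ^ 2)⁻¹ : ℝ) *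
        (ENNReal.log (ENNReal.ofReal (√2 ^ (n * (N * (N - 1)) * m ^ 2))) + s)
        + (((Fintype.card (Fin n) : ℝ) / 2 * Real.log (N * m : ℕ) : ℝ) : EReal))
      = ((((m : ℝ) ^ 2)⁻¹ : ℝ) : EReal) * s
        + (((Fintype.card (Fin n × Fin N × Fin N) : ℝ) / 2 * Real.log m : ℝ) : EReal) := by
  have hN' : (0 : ℝ) < N := by exact_mod_cast hN
  have hm' : (0 : ℝ) < m := by exact_mod_cast hm
  have h1 : (0 : ℝ) < (((N * m : ℕ) : ℝ) ^ 2)⁻¹ := by push_cast; positivity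
  have h2 : (0 : ℝ) < ((m : ℝ) ^ 2)⁻¹ := by positivity
  rw [log_ofReal_jacobian n N m hN]
  change (((N : ℝ) ^ 2 : ℝ) : EReal) * _ - _ = _
  induction s with
  | bot =>
    rw [EReal.add_bot, EReal.coe_mul_bot_of_pos h1, EReal.coe_mul_bot_of_pos h2, EReal.bot_add,
      EReal.bot_add, EReal.coe_mul_bot_of_pos (by positivity), EReal.bot_sub]
  | top =>
    rw [EReal.coe_add_top, EReal.coe_mul_top_of_pos h1, EReal.coe_mul_top_of_pos h2,
      EReal.top_add_coe, EReal.top_add_coe, EReal.coe_mul_top_of_pos (by positivity),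
      EReal.top_sub_coe]
  | coe s =>
    norm_cast
    simp only [Fintype.card_prod, Fintype.card_fin, entropyShift]
    push_cast
    rw [Real.log_mul hN'.ne' hm'.ne']
    field_simp
    ring

end Arithmetic

/-! ### From microstates of entries to microstates of matrices. -/

section Assemble

variable {M : Type*} [Ring M] [StarRing M] [Algebra ℂ M] {τ : M →ₗ[ℂ] ℂ} {n p N : ℕ}

/-- Assembling matrices from their blocks, as a multiplicative map. -/
def IsFrame.assembleHom {m k : ℕ} {U : Fin N → Matrix (Fin k) (Fin m) ℂ} (hU : IsFrame U) :
    Matrix (Fin N) (Fin N) (Matrix (Fin m) (Fin m) ℂ) →* Matrix (Fin k) (Fin k) ℂ where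
  toFun := assemble U
  map_one' := hU.assemble_one
  map_mul' := hU.assemble_mul

/-- Two tuples of matrices, from the self-adjoint parts of their entries. -/
def matricesOfParts {A : Type*} [Ring A] [Algebra ℂ A]
    (y : (Fin n × Fin N × Fin N) ⊕ (Fin p × Fin N × Fin N) → A) :
    Fin n ⊕ Fin p → Matrix (Fin N) (Fin N) A :=
  Sum.elim (fun k => Matrix.of (ofParts (y ∘ Sum.inl) k)) fun k =>
    Matrix.of (ofParts (y ∘ Sum.inr) k)

theorem mapMatrix_matricesOfParts {A A' : Type*} [Ring A] [Algebra ℂ A] [Ring A'] [Algebra ℂ A']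
    (f : A →ₐ[ℂ] A') (y : (Fin n × Fin N × Fin N) ⊕ (Fin p × Fin N × Fin N) → A)
    (q : Fin n ⊕ Fin p) : f.mapMatrix (matricesOfParts y q) = matricesOfParts (f ∘ y) q := by
  ext i j
  rcases q with k | k
  · exact map_ofParts f _ k i j
  · exact map_ofParts f _ k i j

theorem isSelfAdjoint_ofParts {A : Type*} [Ring A] [StarRing A] [Algebra ℂ A] [StarModule ℂ A]
    {y : Fin n × Fin N × Fin N → A} (hy : ∀ q, star (y q) = y q) (k : Fin n) (i j : Fin N) :
    star (ofParts y k j i) = ofParts y k i j := by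
  rcases lt_trichotomy i j with h | h | h
  · simp [ofParts, h.ne, h.ne', h, h.not_gt, hy, sub_eq_add_neg]
  · subst h
    simp [ofParts, hy]
  · simp [ofParts, h.ne, h.ne', h, h.not_gt, hy, sub_eq_add_neg]

theorem norm_ofParts_le {m : ℕ} {y : Fin n × Fin N × Fin N → Matrix (Fin m) (Fin m) ℂ} {R : ℝ}
    (hy : ∀ q, ‖y q‖ ≤ R) (k : Fin n) (i j : Fin N) : ‖ofParts y k i j‖ ≤ 2 * R := by
  have hI : ∀ q, ‖Complex.I • y q‖ ≤ R := fun q => by simpa [norm_smul] using hy q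
  have hR : 0 ≤ R := (norm_nonneg _).trans (hy (k, i, j))
  simp only [ofParts]
  split_ifs
  · linarith [hy (k, i, i)]
  · linarith [norm_sub_le (y (k, i, j)) (Complex.I • y (k, j, i)), hy (k, i, j), hI (k, j, i)]
  · linarith [norm_add_le (y (k, j, i)) (Complex.I • y (k, i, j)), hy (k, j, i), hI (k, i, j)]

/-- A trace of a word in matrices is one fixed noncommutative polynomial in the self-adjoint parts,
so convergence of their moments applies to it directly. -/
theorem lift_trace_prod_matricesOfParts {A : Type*} [Ring A] [Algebra ℂ A]
    (v : (Fin n × Fin N × Fin N) ⊕ (Fin p × Fin N × Fin N) → A) (w : List (Fin n ⊕ Fin p)) :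
    FreeAlgebra.lift ℂ v (w.map (matricesOfParts (FreeAlgebra.ι ℂ))).prod.trace
      = (w.map (matricesOfParts v)).prod.trace := by
  have e1 : ∀ c : Matrix (Fin N) (Fin N) (FreeAlgebra ℂ _),
      FreeAlgebra.lift ℂ v c.trace = ((FreeAlgebra.lift ℂ v).mapMatrix c).trace := by
    intro c
    simp [Matrix.trace]
  rw [e1, map_list_prod, List.map_map]
  congr 3
  funext q
  simp only [Function.comp_apply]
  rw [mapMatrix_matricesOfParts, FreeAlgebra.ι_comp_lift]

/-- Matrices of microstates are microstates of matrices. -/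
theorem exists_assemble_mem_microstates (X : Fin n → Matrix (Fin N) (Fin N) M)
    (hX : ∀ k i j, X k i j = star (X k j i)) (W : Fin p → Matrix (Fin N) (Fin N) M)
    (hW : ∀ k i j, W k i j = star (W k j i)) (R : ℝ) (l : ℕ) {ε : ℝ} (hε : 0 < ε) :
    ∃ (l' : ℕ) (ε' : ℝ), 0 < ε' ∧ ∀ m, 0 < m → ∀ y ∈ microstates τ
      (Sum.elim (entryParts X) (entryParts W)) R m l' ε',
      ∀ U : Fin N → Matrix (Fin (N * m)) (Fin m) ℂ, IsFrame U →
        (fun q => assemble U (matricesOfParts y q)) ∈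
          microstates (matTrace N τ) (Sum.elim X W) (N * (N * (2 * R))) (N * m) l ε := by
  have key := exists_forall_mem_microstates_map τ (Sum.elim (entryParts X) (entryParts W)) R
    (fun m => m) (fun m => N * m) (matTrace N τ) (Sum.elim X W) (N * (N * (2 * R))) l hε
    (fun m y => {z | ∃ U : Fin N → Matrix (Fin (N * m)) (Fin m) ℂ, IsFrame U ∧
      z = fun q => assemble U (matricesOfParts y q)}) ?_ ?_
  · obtain ⟨l', ε', hε', h⟩ := key
    exact ⟨l', ε', hε', fun m hm y hy U hU => h m hm y hy _ ⟨U, hU, rfl⟩⟩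
  · rintro m - y hy hyR _ ⟨U, hU, rfl⟩
    refine ⟨fun q => ?_, fun q => hU.norm_assemble_le _ fun i j => ?_⟩
    · rw [IsHermitian, conjTranspose_assemble]
      congr 1
      ext1 i j
      rcases q with k | k
      · exact isSelfAdjoint_ofParts (fun q => hy (Sum.inl q)) k i j
      · exact isSelfAdjoint_ofParts (fun q => hy (Sum.inr q)) k i j
    · rcases q with k | k
      · exact norm_ofParts_le (fun q => hyR (Sum.inl q)) k i j
      · exact norm_ofParts_le (fun q => hyR (Sum.inr q)) k i j
  · intro m y z hm hy hyR hz hmom w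
    choose U hU hz using hz
    have h1 := (hmom.tendsto_lift
      (w.map (matricesOfParts (FreeAlgebra.ι ℂ))).prod.trace).const_mul (N : ℂ)⁻¹
    have hlim : matricesOfParts (Sum.elim (entryParts X) (entryParts W)) = Sum.elim X W := by
      funext q
      rcases q with k | k
      · simp only [matricesOfParts, Sum.elim_comp_inl, Sum.elim_inl]
        rw [ofParts_entryParts hX]
        rfl
      · simp only [matricesOfParts, Sum.elim_comp_inr, Sum.elim_inr]
        rw [ofParts_entryParts hW]
        rfl
    rw [lift_trace_prod_matricesOfParts, hlim, ← matTrace_apply] at h1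
    refine h1.congr fun t => ?_
    have h2 : (w.map (z t)).prod = assemble (U t) (w.map (matricesOfParts (y t))).prod := by
      have h3 := map_list_prod (hU t).assembleHom (w.map (matricesOfParts (y t)))
      rw [List.map_map] at h3
      rw [hz]
      exact h3.symm
    rw [lift_trace_prod_matricesOfParts, h2, (hU t).trace_assemble]
    push_cast
    rw [mul_inv, mul_assoc]

end Assemble

/-! ### The inequality valid for any limit along multiples of `N`. -/

section UpperBound

variable {M : Type*} [Ring M] [StarRing M] [Algebra ℂ M] {τ : M →ₗ[ℂ] ℂ} {n p N : ℕ}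

theorem IsFrame.assemble_ofParts_blockParts {m k : ℕ} {U : Fin N → Matrix (Fin k) (Fin m) ℂ}
    (hU : IsFrame U) (z : Fin n → Matrix (Fin k) (Fin k) ℂ) (a : Fin n) :
    assemble U (Matrix.of (ofParts (blockParts U z) a)) = z a := by
  rw [blockParts, ofParts_symParts, hU.assemble_compress]

/-- The condition on the filters says that sizes `N m` are among those seen by `G`. The new radius
has a factor `2` from recombining real and imaginary parts and `N ^ 2` from assembling blocks. -/
theorem chiR_entryParts_le {F G : Filter ℕ} (hF : F ≤ atTop) (hFG : F.map (fun m => N * m) ≤ G)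
    (hN : 0 < N) (X : Fin n → Matrix (Fin N) (Fin N) M)
    (hX : ∀ k i j, X k i j = star (X k j i)) (W : Fin p → Matrix (Fin N) (Fin N) M)
    (hW : ∀ k i j, W k i j = star (W k j i)) (R : ℝ) :
    chiR F τ (entryParts X) (entryParts W) R
      ≤ entropyIso n N hN (chiR G (matTrace N τ) X W (N * (N * (2 * R)))) := by
  rw [← OrderIso.symm_apply_le]
  refine le_iInf fun l => le_iInf₂ fun ε hε => ?_
  rw [OrderIso.symm_apply_le]
  obtain ⟨l', ε', hε', h⟩ := exists_assemble_mem_microstates (τ := τ) X hX W hW R l hε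
  refine (iInf_le_of_le l' (iInf₂_le_of_le ε' hε' le_rfl)).trans ?_
  refine le_trans ?_ ((entropyIso n N hN).monotone (limsup_le_limsup_of_le hFG))
  rw [← limsup_comp, OrderIso.limsup_apply]
  refine limsup_le_limsup ?_
  filter_upwards [hF (eventually_gt_atTop 0)] with m hm
  simp only [Function.comp_apply]
  rw [← entropyIso_normalized n N m hN hm]
  refine (entropyIso n N hN).monotone (add_le_add_left (mul_le_mul_of_nonneg_left ?_
    (EReal.coe_nonneg.2 (by positivity))) _)
  obtain ⟨U, hU⟩ := exists_isFrame N m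
  -- The finite Jacobian term is moved to the other side so that the supremum over `b` stands alone
  -- on the left.
  rw [log_ofReal_jacobian n N m hN, add_comm,
    ← EReal.le_sub_iff_add_le (Or.inl (EReal.coe_ne_bot _)) (Or.inl (EReal.coe_ne_top _))]
  refine iSup₂_le fun b _ => ?_
  -- An empty fibre contributes `⊥`. A point of a nonempty one shows that the assembled `b` is an
  -- admissible conditioning microstate.
  rcases Set.eq_empty_or_nonempty
    (relMicrostates τ (entryParts X) (entryParts W) R m l' ε' b) with hemp | ⟨y, hy⟩
  · rw [log_lebesgue_of_eq_empty hemp]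
    exact bot_le
  rw [EReal.le_sub_iff_add_le (Or.inl (EReal.coe_ne_bot _)) (Or.inl (EReal.coe_ne_top _)),
    add_comm, ← log_ofReal_jacobian n N m hN, ← ENNReal.log_mul_add,
    ← hU.lebesgue_preimage_blockParts rfl]
  have hw := comp_mem_microstates (h m hm _ hy U hU) Sum.inr
  refine le_trans (ENNReal.log_monotone (lebesgue_mono ?_)) (le_iSup₂
    (f := fun w (_ : w ∈ microstates (matTrace N τ) W (N * (N * (2 * R))) (N * m) l ε) =>
      ENNReal.log (lebesgue (relMicrostates (matTrace N τ) X W (N * (N * (2 * R))) (N * m) l ε w)))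
    (fun a => assemble U (Matrix.of (ofParts b a))) hw)
  intro z hz
  change Sum.elim z (fun a => assemble U (Matrix.of (ofParts b a))) ∈ microstates _ _ _ _ _ _
  refine Set.mem_of_eq_of_mem ?_ (h m hm _ hz U hU)
  funext q
  rcases q with a | a
  · exact (hU.assemble_ofParts_blockParts z a).symm
  · rfl

theorem chi_entryParts_le [StarModule ℂ M] {F G : Filter ℕ} (hF : F ≤ atTop)
    (hFG : F.map (fun m => N * m) ≤ G)
    (hN : 0 < N) (B : Subalgebra ℂ M) (X : Fin n → Matrix (Fin N) (Fin N) M)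
    (hX : ∀ k i j, X k i j = star (X k j i)) :
    chi F τ (entryParts X) B ≤ entropyIso n N hN (chi G (matTrace N τ) X B.matrix) := by
  rw [← OrderIso.symm_apply_le]
  refine le_iInf fun p => le_iInf₂ fun W hW => ?_
  rw [OrderIso.symm_apply_le]
  have hW' : ∀ k i j, W k i j = star (W k j i) := fun k i j =>
    (congrFun (congrFun (hW k).2 i) j).symm
  refine (chi_le_chiRel F (entryParts X) (Y := entryParts W) fun q =>
    ⟨entryParts_mem hW' (fun k i j => (hW k).1 i j) q, isSelfAdjoint_entryParts W q⟩).trans ?_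
  refine iSup₂_le fun R hR => (chiR_entryParts_le hF hFG hN X hX W hW' R).trans
    ((entropyIso n N hN).monotone ?_)
  have hN' : (0 : ℝ) < N := by exact_mod_cast hN
  exact le_iSup₂ (f := fun R (_ : 0 < R) => chiR G (matTrace N τ) X W R) (N * (N * (2 * R)))
    (by positivity)

end UpperBound

/-! ### The reverse inequality along multiples of `N`. -/

section LowerBound

variable {M : Type*} [Ring M] [StarRing M] [Algebra ℂ M] {τ : M →ₗ[ℂ] ℂ} {n p N : ℕ}

/-- The matrix unit `e_{oo}`, permutation matrices which conjugate it to the other diagonal matrix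
units, and the scalar matrices with entries `b`. -/
def unitsAndScalars (o : Fin N) (b : Fin p → M) :
    Unit ⊕ Fin N ⊕ Fin p → Matrix (Fin N) (Fin N) M :=
  Sum.elim (fun _ => single o o 1) (Sum.elim (fun i => (Equiv.swap o i).permMatrix M)
    fun a => diagonal fun _ => b a)

theorem unitsAndScalars_mem (o : Fin N) {B : Subalgebra ℂ M} {b : Fin p → M}
    (hb : ∀ a, b a ∈ B ∧ IsSelfAdjoint (b a)) (q : Unit ⊕ Fin N ⊕ Fin p) :
    unitsAndScalars o b q ∈ B.matrix ∧ IsSelfAdjoint (unitsAndScalars o b q) := by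
  rcases q with q | i | a
  · refine ⟨fun i j => ?_, ?_⟩
    · simp only [unitsAndScalars, Sum.elim_inl, single_apply]
      split_ifs
      exacts [B.one_mem, B.zero_mem]
    · simp [unitsAndScalars, IsSelfAdjoint, star_eq_conjTranspose]
  · refine ⟨fun j k => ?_, ?_⟩
    · simp only [unitsAndScalars, Sum.elim_inl, Sum.elim_inr, Equiv.Perm.permMatrix,
        PEquiv.toMatrix_apply]
      split_ifs
      exacts [B.one_mem, B.zero_mem]
    · simp [unitsAndScalars, IsSelfAdjoint, star_eq_conjTranspose, conjTranspose_permMatrix]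
  · refine ⟨fun i j => ?_, ?_⟩
    · simp only [unitsAndScalars, Sum.elim_inr, diagonal_apply]
      split_ifs
      exacts [(hb a).1, B.zero_mem]
    · have := (hb a).2.star_eq
      simp [unitsAndScalars, IsSelfAdjoint, star_eq_conjTranspose, diagonal_conjTranspose,
        Pi.star_def, this]

omit [StarRing M] [Algebra ℂ M] in
theorem permMatrix_swap_mul_single (o i : Fin N) :
    (Equiv.swap o i).permMatrix M * single o o 1 = single i o 1 := by
  ext j k
  have h : o = Equiv.swap o i j ↔ i = j := by
    rw [eq_comm, Equiv.swap_apply_eq_iff, Equiv.swap_apply_left, eq_comm]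
  rw [Equiv.Perm.permMatrix, PEquiv.toMatrix_toPEquiv_mul, submatrix_apply, single_apply,
    single_apply]
  simp only [id, h]

omit [StarRing M] [Algebra ℂ M] in
theorem single_mul_permMatrix_swap (o i : Fin N) :
    single o o 1 * (Equiv.swap o i).permMatrix M = single o i 1 := by
  ext j k
  have h : o = Equiv.swap o i k ↔ i = k := by
    rw [eq_comm, Equiv.swap_apply_eq_iff, Equiv.swap_apply_left, eq_comm]
  rw [Equiv.Perm.permMatrix, PEquiv.mul_toMatrix_toPEquiv, submatrix_apply, single_apply,
    single_apply]
  simp only [id, Equiv.symm_swap, h]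

/-- The self-adjoint parts of the blocks of the first `n` matrices of a tuple, and one block of
each of the last `p` ones. -/
def partsAlong {m k : ℕ} (U : Fin N → Matrix (Fin k) (Fin m) ℂ) (o : Fin N)
    (x : Fin n ⊕ (Unit ⊕ Fin N ⊕ Fin p) → Matrix (Fin k) (Fin k) ℂ) :
    (Fin n × Fin N × Fin N) ⊕ Fin p → Matrix (Fin m) (Fin m) ℂ :=
  Sum.elim (blockParts U (x ∘ Sum.inl)) fun a => compress U (x (Sum.inr (Sum.inr (Sum.inr a)))) o o

theorem norm_blockParts_le {m k : ℕ} {U : Fin N → Matrix (Fin k) (Fin m) ℂ} (hU : IsFrame U)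
    {z : Fin n → Matrix (Fin k) (Fin k) ℂ} {R : ℝ} (hz : ∀ a, ‖z a‖ ≤ R)
    (q : Fin n × Fin N × Fin N) : ‖blockParts U z q‖ ≤ R := by
  have h : ∀ i j, ‖compress U (z q.1) i j‖ ≤ R := fun i j =>
    (hU.norm_compress_le _ i j).trans (hz q.1)
  simp only [blockParts, symParts]
  split_ifs
  · rw [norm_smul]
    have := norm_add_le (compress U (z q.1) q.2.1 q.2.2) (compress U (z q.1) q.2.2 q.2.1)
    norm_num
    linarith [h q.2.1 q.2.2, h q.2.2 q.2.1]
  · rw [norm_smul]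
    have := norm_sub_le (compress U (z q.1) q.2.1 q.2.2) (compress U (z q.1) q.2.2 q.2.1)
    norm_num
    linarith [h q.2.1 q.2.2, h q.2.2 q.2.1]

/-- The blocks, along an adapted frame, of microstates of matrices are microstates of the
entries. -/
theorem exists_partsAlong_mem_microstates (hτ : τ 1 = 1) (o : Fin N)
    (X : Fin n → Matrix (Fin N) (Fin N) M) (hX : ∀ k i j, X k i j = star (X k j i))
    (b : Fin p → M) (R : ℝ) (l : ℕ) {ε : ℝ} (hε : 0 < ε) :
    ∃ (l' : ℕ) (ε' : ℝ), 0 < ε' ∧ ∀ m, 0 < m →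
      ∀ x ∈ microstates (matTrace N τ) (Sum.elim X (unitsAndScalars o b)) R (N * m) l' ε',
      ∀ U : Fin N → Matrix (Fin (N * m)) (Fin m) ℂ,
        IsAdapted (x (Sum.inr (Sum.inl ()))) (fun i => x (Sum.inr (Sum.inr (Sum.inl i)))) U →
        partsAlong U o x ∈ microstates τ (Sum.elim (entryParts X) b) R m l ε := by
  have key := exists_forall_mem_microstates_map (matTrace N τ)
    (Sum.elim X (unitsAndScalars o b)) R (fun m => N * m) (fun m => m) τ
    (Sum.elim (entryParts X) b) R l hε
    (fun m x => {y | ∃ U : Fin N → Matrix (Fin (N * m)) (Fin m) ℂ,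
      IsAdapted (x (Sum.inr (Sum.inl ()))) (fun i => x (Sum.inr (Sum.inr (Sum.inl i)))) U ∧
      y = partsAlong U o x}) ?_ ?_
  · obtain ⟨l', ε', hε', h⟩ := key
    exact ⟨l', ε', hε', fun m hm x hx U hU => h m hm x hx _ ⟨U, hU, rfl⟩⟩
  · rintro m - x hx hxR _ ⟨U, hU, rfl⟩
    refine ⟨fun q => ?_, fun q => ?_⟩
    · rcases q with q | a
      · exact isHermitian_blockParts (fun a => hx _) q
      · exact (conjTranspose_compress _ o o).trans (congrArg (fun z => compress U z o o) (hx _).eq)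
    · rcases q with q | a
      · exact norm_blockParts_le hU.1 (fun a => hxR _) q
      · exact (hU.1.norm_compress_le _ o o).trans (hxR _)
  · intro m x y hm hx hxR hy hmom
    choose U hU hy using hy
    have h1 := hmom.blocks hτ hm hx hxR (Sum.inr (Sum.inl ()))
      (fun i => Sum.inr (Sum.inr (Sum.inl i))) o rfl (permMatrix_swap_mul_single o)
      (single_mul_permMatrix_swap o) hU
    -- The parts are linear in the blocks, and the `(o, o)` entry of a constant diagonal matrix
    -- recovers `b`.
    have h2 := h1.lift (Sum.elim
      (symParts fun (k : Fin n) i j => FreeAlgebra.ι ℂ (Sum.inl k, i, j))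
      fun a : Fin p => FreeAlgebra.ι ℂ (Sum.inr (Sum.inr (Sum.inr a)), o, o))
    refine Eq.mp ?_ h2
    congr 1
    · funext q
      rcases q with q | a
      · simp only [Sum.elim_inl, map_symParts, FreeAlgebra.lift_ι_apply]
        rw [entryParts_eq_symParts hX]
      · simp [unitsAndScalars]
    · funext t q
      rw [hy]
      rcases q with q | a
      · simp only [Sum.elim_inl, map_symParts, FreeAlgebra.lift_ι_apply]
        rfl
      · simp [partsAlong]

/-- Compression to blocks and taking self-adjoint parts do not increase norms, so the same `R`
serves on both sides. -/
theorem entropyIso_chiR_le {F : Filter ℕ} (hF : F ≤ atTop) (hτ : τ 1 = 1)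
    (hN : 0 < N) (o : Fin N) (X : Fin n → Matrix (Fin N) (Fin N) M)
    (hX : ∀ k i j, X k i j = star (X k j i)) (b : Fin p → M) (R : ℝ) :
    entropyIso n N hN (chiR (F.map fun m => N * m) (matTrace N τ) X (unitsAndScalars o b) R)
      ≤ chiR F τ (entryParts X) b R := by
  refine le_iInf fun l => le_iInf₂ fun ε hε => ?_
  obtain ⟨l', ε', hε', h⟩ := exists_partsAlong_mem_microstates (τ := τ) hτ o X hX b R l hε
  refine ((entropyIso n N hN).monotone (iInf_le_of_le l' (iInf₂_le_of_le ε' hε' le_rfl))).trans ?_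
  rw [chiRle, ← limsup_comp, OrderIso.limsup_apply]
  refine limsup_le_limsup ?_
  filter_upwards [hF (eventually_gt_atTop 0)] with m hm
  simp only [Function.comp_apply]
  rw [← entropyIso_normalized n N m hN hm]
  refine (entropyIso n N hN).monotone (add_le_add_left (mul_le_mul_of_nonneg_left ?_
    (EReal.coe_nonneg.2 (by positivity))) _)
  refine iSup₂_le fun w _ => ?_
  rcases Set.eq_empty_or_nonempty (relMicrostates (matTrace N τ) X (unitsAndScalars o b) R (N * m)
    l' ε' w) with hemp | ⟨z, hz⟩
  · rw [log_lebesgue_of_eq_empty hemp]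
    exact bot_le
  -- The frame is built from `w` alone, so `blockParts U` is one fixed linear map on the whole fibre
  -- over `w`.
  obtain ⟨U, hU⟩ := exists_isAdapted (w (Sum.inl ())) (fun i => w (Sum.inr (Sum.inl i)))
  have hb := comp_mem_microstates (h m hm _ hz U hU) Sum.inr
  refine le_trans ?_ (add_le_add_right (le_iSup₂
    (f := fun y (_ : y ∈ microstates τ b R m l ε) =>
      ENNReal.log (lebesgue (relMicrostates τ (entryParts X) b R m l ε y)))
    (fun a => compress U (w (Sum.inr (Sum.inr a))) o o) hb) _)
  rw [← ENNReal.log_mul_add, ← hU.1.lebesgue_preimage_blockParts rfl]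
  exact ENNReal.log_monotone (lebesgue_mono fun z hz => h m hm _ hz U hU)

theorem entropyIso_chi_le {F : Filter ℕ} (hF : F ≤ atTop) (hτ : τ 1 = 1)
    (hN : 0 < N) (B : Subalgebra ℂ M) (X : Fin n → Matrix (Fin N) (Fin N) M)
    (hX : ∀ k i j, X k i j = star (X k j i)) :
    entropyIso n N hN (chi (F.map fun m => N * m) (matTrace N τ) X B.matrix)
      ≤ chi F τ (entryParts X) B := by
  refine le_iInf fun p => le_iInf₂ fun b hb => ?_
  let o : Fin N := ⟨0, hN⟩
  refine ((entropyIso n N hN).monotone (chi_le_chiRel _ X (unitsAndScalars_mem o hb))).trans ?_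
  rw [← OrderIso.le_symm_apply]
  refine iSup₂_le fun R hR => ?_
  rw [OrderIso.le_symm_apply]
  exact (entropyIso_chiR_le hF hτ hN o X hX b R).trans
    (le_iSup₂ (f := fun R (_ : 0 < R) => chiR F τ (entryParts X) b R) R hR)

end LowerBound

end RelFreeEntropy

end

open RelFreeEntropy in
theorem mainTheorem8 {M : Type*} [Ring M] [StarRing M] [Algebra ℂ M] [StarModule ℂ M]
    (τ : M →ₗ[ℂ] ℂ) (hτ : IsTracialState τ) (B : Subalgebra ℂ M)
    (n N : ℕ) (hN : 0 < N) (X : Fin n → Fin N → Fin N → M)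
    (hX : ∀ k i j, X k i j = star (X k j i)) :
    (∀ ω : Ultrafilter ℕ, (ω : Filter ℕ) ≤ Filter.cofinite →
      chi (ω : Filter ℕ) τ (entryParts X) B
        = (((N : ℝ) ^ 2 : ℝ) : EReal) *
            chi (mulUltrafilter N ω : Filter ℕ) (matTrace N τ)
              (fun k : Fin n => (Matrix.of (X k) : Matrix (Fin N) (Fin N) M)) B.matrix
          - (((N : ℝ) ^ 2 * ((n : ℝ) / 2) * Real.log N
              + (n : ℝ) * (N : ℝ) * ((N : ℝ) - 1) / 2 * Real.log 2 : ℝ) : EReal)) ∧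
    chi Filter.atTop τ (entryParts X) B
      ≤ (((N : ℝ) ^ 2 : ℝ) : EReal) *
          chi Filter.atTop (matTrace N τ)
            (fun k : Fin n => (Matrix.of (X k) : Matrix (Fin N) (Fin N) M)) B.matrix
        - (((N : ℝ) ^ 2 * ((n : ℝ) / 2) * Real.log N
            + (n : ℝ) * (N : ℝ) * ((N : ℝ) - 1) / 2 * Real.log 2 : ℝ) : EReal) := by
  refine ⟨fun ω hω => ?_, ?_⟩
  · rw [Nat.cofinite_eq_atTop] at hω
    -- The right-hand side is `entropyIso` by definition, and `mulUltrafilter N ω` is the image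
    -- filter, so both bounds apply with the same filter.
    exact le_antisymm (chi_entryParts_le hω le_rfl hN B (fun k => Matrix.of (X k)) hX)
      (entropyIso_chi_le hω hτ.map_one hN B (fun k => Matrix.of (X k)) hX)
  -- The multiples of `N` tend to infinity, so the limsup along them is at most the full limsup.
  · exact chi_entryParts_le le_rfl
      (Filter.tendsto_id.const_mul_atTop' hN) hN B (fun k => Matrix.of (X k)) hX
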